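/- Let $\tau\in\mathbb C$ with $\operatorname{Im}\tau>0$ and let $\Lambda=\mathbb Z\oplus\mathbb Z\tau$. A character of $\Lambda$ is a group homomorphism $\psi:\Lambda\to\{z\in\mathbb C:|z|=1\}$. For $x>0$ put $$Z(x,\Lambda,\psi)=\sum_{\mu\in\Lambda,\ 0<|\mu|^2\le x}\frac{\psi(\mu)}{|\mu|^2},\qquad L(\Lambda,\psi)=\lim_{x\to\infty}Z(x,\Lambda,\psi)\ \text{ when the limit exists.}$$ For $a_1,a_2\in\mathbb R$ the Siegel function is $$g_{a_1,a_2}(\tau)=-q_\tau^{B_2(a_1)/2}\,e^{2\pi i a_2(a_1-1)/2}\,(1-q_z)\prod_{n=1}^\infty(1-q_\tau^nq_z)(1-q_\tau^n/q_z),$$ where $B_2(X)=X^2-X+\tfrac16$, $z=a_1\tau+a_2$, $q_z=e^{2\pi i z}$, $q_\tau^{r}=e^{2\pi i r\tau}$ for $r\in\mathbb R$. (1) If $\psi$ is the trivial character, there is a real constant $\eta_\Lambda$ with $$Z(x,\Lambda,\psi)=\frac{\pi}{|\Lambda|}(\ln x+\eta_\Lambda)+O(x^{-1/2})\quad(x\to\infty),$$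 where $|\Lambda|$ is the area of a fundamental domain of $\Lambda$. (2) If $\psi$ is nontrivial, then $L(\Lambda,\psi)=\lim_{x\to\infty}Z(x,\Lambda,\psi)$ exists and $$Z(x,\Lambda,\psi)=L(\Lambda,\psi)+O(x^{-1/2})\quad(x\to\infty).$$ (3) Let $u,v\in\mathbb R$ be not both integers and let $\psi$ be a character of $\Lambda$ with $\psi(1)=e^{2\pi i v}$ and $\psi(\tau)=e^{2\pi i u}$, that is, $\psi(m\tau+n)=e^{2\pi i(mu+nv)}$. Then $\psi$ is nontrivial, $g_{-v,u}(\tau)\neq0$, and $$L(\Lambda,\psi)=-\frac{2\pi}{\operatorname{Im}\tau}\log\bigl|g_{-v,u}(\tau)\bigr|.$$ The implied constants may depend on $\tau$ and $\psi$. -/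

import Mathlib

open Filter Topology Asymptotics
open scoped UpperHalfPlane

namespace LatticeSum

/-- The pair of periods `1`, `τ`, so that `(periods τ).lattice` is the lattice `ℤ ⊕ ℤτ` in `ℂ`. -/
noncomputable def periods (τ : ℍ) : PeriodPair where
  ω₁ := 1
  ω₂ := (τ : ℂ)
  indep := by
    rw [LinearIndependent.pair_iff]
    intro s t h
    have him := congrArg Complex.im h
    have hre := congrArg Complex.re h
    have hτ : (τ : ℂ).im ≠ 0 := τ.im_ne_zero
    simp only [Complex.add_im, Complex.real_smul, Complex.mul_im, Complex.ofReal_re,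
      Complex.ofReal_im, Complex.one_im, Complex.zero_im, mul_zero, zero_mul, add_zero,
      zero_add] at him
    have ht : t = 0 := (mul_eq_zero.mp him).resolve_right hτ
    subst ht
    simpa using hre

/-- The lattice `Λ = ℤ ⊕ ℤτ`. -/
noncomputable abbrev lattice (τ : ℍ) : Submodule ℤ ℂ := (periods τ).lattice

/-- `1` as an element of `Λ`. -/
noncomputable def one (τ : ℍ) : lattice τ := ⟨1, (periods τ).ω₁_mem_lattice⟩

/-- `τ` as an element of `Λ`. -/
noncomputable def gen (τ : ℍ) : lattice τ := ⟨(τ : ℂ), (periods τ).ω₂_mem_lattice⟩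

/-- A lattice character: a one-dimensional unitary representation of `Λ`. -/
abbrev LatticeChar (τ : ℍ) := AddChar (lattice τ) Circle

theorem finite_punctured_disc (τ : ℍ) (x : ℝ) :
    {μ : lattice τ | μ ≠ 0 ∧ ‖(μ : ℂ)‖ ^ 2 ≤ x}.Finite := by
  refine ((isCompact_closedBall (0 : lattice τ) (Real.sqrt x)).finite
    ⟨inferInstance⟩).subset ?_
  rintro μ ⟨-, hμ⟩
  rw [mem_closedBall_zero_iff]
  exact Real.le_sqrt_of_sq_le hμ

/-- `Z(x, Λ, ψ)`, the sum of `ψ(μ) / |μ|²` over the `μ ∈ Λ` with `μ ≠ 0` and `|μ|² ≤ x`. -/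
noncomputable def Z (τ : ℍ) (ψ : LatticeChar τ) (x : ℝ) : ℂ :=
  ∑ μ ∈ (finite_punctured_disc τ x).toFinset, (ψ μ : ℂ) / ((‖(μ : ℂ)‖ ^ 2 : ℝ) : ℂ)

/-- `L(Λ, ψ)`, the limit of `Z(x, Λ, ψ)` as `x → ∞` (meaningful when the limit exists). -/
noncomputable def L (τ : ℍ) (ψ : LatticeChar τ) : ℂ := limUnder atTop (Z τ ψ)

/-- The second Bernoulli polynomial `X² - X + 1/6`. -/
noncomputable def B₂ (a : ℝ) : ℝ := a ^ 2 - a + 1 / 6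

/-- `e(z) = exp(2πiz)`. -/
noncomputable def e (z : ℂ) : ℂ := Complex.exp (2 * Real.pi * Complex.I * z)

/-- The Siegel function
`g_{a₁,a₂}(τ) = - q_τ^{B₂(a₁)/2} e(a₂(a₁-1)/2) (1 - q_z) ∏_{n ≥ 1} (1 - q_τⁿ q_z)(1 - q_τⁿ / q_z)`,
where `q_τ = e(τ)`, `q_z = e(z)` and `z = a₁τ + a₂`. -/
noncomputable def siegel (a₁ a₂ : ℝ) (τ : ℍ) : ℂ :=
  -e ((B₂ a₁ / 2 : ℝ) * τ) * e ((a₂ * (a₁ - 1) / 2 : ℝ)) * (1 - e (a₁ * τ + a₂)) *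
    ∏' n : ℕ, ((1 - e τ ^ (n + 1) * e (a₁ * τ + a₂)) * (1 - e τ ^ (n + 1) / e (a₁ * τ + a₂)))

/-- The infinite product in the Siegel function converges. -/
theorem multipliable_siegel (a₁ a₂ : ℝ) (τ : ℍ) :
    Multipliable fun n : ℕ =>
      (1 - e τ ^ (n + 1) * e (a₁ * τ + a₂)) * (1 - e τ ^ (n + 1) / e (a₁ * τ + a₂)) := by
  have hq : ‖e (τ : ℂ)‖ < 1 := by
    simpa [e, Function.Periodic.qParam] using UpperHalfPlane.norm_exp_two_pi_I_lt_one τ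
  have hs : Summable fun n : ℕ => e (τ : ℂ) ^ (n + 1) :=
    (summable_nat_add_iff 1).mpr (summable_geometric_of_norm_lt_one hq)
  have key : ∀ c : ℂ, Multipliable fun n : ℕ => 1 - e (τ : ℂ) ^ (n + 1) * c := fun c => by
    simpa [sub_eq_add_neg] using
      Complex.multipliable_one_add_of_summable (hs.mul_right c).neg
  simpa only [div_eq_mul_inv] using (key _).mul (key _)

end LatticeSum

namespace LatticeSum

open MeasureTheory Metric
open scoped Pointwise ComplexConjugate

/-! Convergence: translates of a fundamental domain show that a disc of radius R holds πR²/|Λ| +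
O(R) lattice points, so an annulus of fixed width holds O(R). For ψ(ν) ≠ 1, multiplying the sum of ψ
over the disc by 1 - ψ(ν) leaves only boundary terms, so that sum is O(R). Partial summation with R
= √x then gives (1) and (2) (`exists_sum_div_normSq_isBigO`).

Evaluation: the series for L converges only conditionally, but (1 - ψ(ν))L is the sum of ψ(μ)|μ|⁻² -
ψ(ν)ψ(μ-ν)|μ-ν|⁻², whose terms are O(|μ|⁻³) (`hasSum_term_sub`). It may therefore be summed along
the rows mτ + ℤ. Undoing the factor 1 - ψ(ν), with ν = 1 or ν = τ, gives L as the limit of symmetric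
sums of rows (`tendsto_sum_rows`).

For 0 ≤ v < 1 each row is a Fourier series with a closed form: row 0 gives 2π²B₂(v), and row m > 0
gives quotients with denominator 1 - qᵐ, where q = e(τ). Expanding these geometrically and summing
over m produces the logarithms of |1 - αqʲ| and |1 - βqʲ|, where α = e(u + (1-v)τ) and β = e(-u +
vτ). These are the factors of the Siegel product (`L_eq_log`). General v reduces to this range
because |g| is 1-periodic in its first index. -/

/-! ### Lattice points in discs and annuli -/

theorem covolume_lattice_pos (τ : ℍ) : 0 < ZLattice.covolume (lattice τ) :=
  ZLattice.covolume_pos (lattice τ) volume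

theorem finite_disc (τ : ℍ) (R : ℝ) : {μ : lattice τ | ‖(μ : ℂ)‖ ≤ R}.Finite := by
  refine ((isCompact_closedBall (0 : lattice τ) R).finite ⟨inferInstance⟩).subset fun μ hμ => ?_
  rw [mem_closedBall_zero_iff]
  exact hμ

/-- The lattice points of norm at most `R`. -/
noncomputable def disc (τ : ℍ) (R : ℝ) : Finset (lattice τ) := (finite_disc τ R).toFinset

@[simp] theorem mem_disc {τ : ℍ} {R : ℝ} {μ : lattice τ} : μ ∈ disc τ R ↔ ‖(μ : ℂ)‖ ≤ R := by
  simp [disc]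

theorem disc_mono (τ : ℍ) : Monotone (disc τ) := fun R S h μ hμ => by
  rw [mem_disc] at *
  exact hμ.trans h

/-- Take d bounding the norm on a fundamental domain F. The translates of F by the points of the
disc are disjoint up to null sets, cover the ball of radius R - d and stay within radius R + d;
compare areas. -/
theorem exists_card_disc_bounds (τ : ℍ) : ∃ d : ℝ, 0 ≤ d ∧ ∀ R : ℝ, d ≤ R →
    Real.pi * (R - d) ^ 2 ≤ ZLattice.covolume (lattice τ) * (disc τ R).card ∧
    ZLattice.covolume (lattice τ) * (disc τ R).card ≤ Real.pi * (R + d) ^ 2 := by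
  set b := ((periods τ).latticeBasis.ofZLatticeBasis ℝ) with hb
  set F := ZSpan.fundamentalDomain b with hF
  have hfund : IsAddFundamentalDomain (lattice τ) F volume :=
    ZLattice.isAddFundamentalDomain (periods τ).latticeBasis volume
  have hspan : Submodule.span ℤ (Set.range b) = lattice τ :=
    (periods τ).latticeBasis.ofZLatticeBasis_span ℝ
  obtain ⟨d, hd⟩ := (ZSpan.fundamentalDomain_isBounded b).exists_norm_le
  have hd0 : 0 ≤ d := (norm_nonneg _).trans (hd _ (ZSpan.fract_mem_fundamentalDomain b 0))
  have hV : ∀ R, volume (⋃ μ ∈ disc τ R, ((μ : lattice τ) +ᵥ F)) =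
      ENNReal.ofReal (ZLattice.covolume (lattice τ) * (disc τ R).card) := by
    intro R
    rw [measure_biUnion_finset₀]
    · have hμ : ∀ μ ∈ disc τ R, volume (μ +ᵥ F) = volume F := fun μ _ =>
        measure_vadd volume (μ : ℂ) F
      rw [Finset.sum_congr rfl hμ, Finset.sum_const, nsmul_eq_mul]
      rw [mul_comm, ENNReal.ofReal_mul (covolume_lattice_pos τ).le, ENNReal.ofReal_natCast,
        ZLattice.covolume_eq_measure_fundamentalDomain _ _ hfund, measureReal_def,
        ENNReal.ofReal_toReal]
      exact (ZSpan.fundamentalDomain_isBounded b).measure_lt_top.ne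
    · intro i _ j _ hij
      exact hfund.aedisjoint hij
    · intro i _
      exact ((ZSpan.fundamentalDomain_measurableSet b).const_vadd (i : ℂ)).nullMeasurableSet
  refine ⟨d, hd0, fun R hR => ⟨?_, ?_⟩⟩
  · have hsub : ball (0 : ℂ) (R - d) ⊆ ⋃ μ ∈ disc τ R, ((μ : lattice τ) +ᵥ F) := by
      intro z hz
      rw [mem_ball_zero_iff] at hz
      have hmem : ((ZSpan.floor b z : Submodule.span ℤ (Set.range b)) : ℂ) ∈ lattice τ := by
        rw [← hspan]; exact (ZSpan.floor b z).2
      have hfr := hd _ (ZSpan.fract_mem_fundamentalDomain b z)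
      simp only [Set.mem_iUnion]
      refine ⟨⟨_, hmem⟩, ?_, ?_⟩
      · rw [mem_disc]
        have : ((ZSpan.floor b z : Submodule.span ℤ (Set.range b)) : ℂ) = z - ZSpan.fract b z := by
          rw [ZSpan.fract_apply]; ring
        calc ‖((ZSpan.floor b z : Submodule.span ℤ (Set.range b)) : ℂ)‖
            = ‖z - ZSpan.fract b z‖ := by rw [this]
          _ ≤ ‖z‖ + ‖ZSpan.fract b z‖ := norm_sub_le _ _
          _ ≤ R := by linarith
      · refine ⟨ZSpan.fract b z, ZSpan.fract_mem_fundamentalDomain b z, ?_⟩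
        change ((ZSpan.floor b z : Submodule.span ℤ (Set.range b)) : ℂ) + ZSpan.fract b z = z
        rw [ZSpan.fract_apply]; ring
    have h := measure_mono (μ := volume) hsub
    rw [hV, Complex.volume_ball, ← ENNReal.ofReal_pow (by linarith)] at h
    rw [← ENNReal.ofReal_le_ofReal_iff (mul_nonneg (covolume_lattice_pos τ).le (Nat.cast_nonneg _)),
      mul_comm, ENNReal.ofReal_mul (by positivity), ← NNReal.coe_real_pi,
      ENNReal.ofReal_coe_nnreal]
    exact h
  · have hsub : (⋃ μ ∈ disc τ R, ((μ : lattice τ) +ᵥ F)) ⊆ closedBall (0 : ℂ) (R + d) := by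
      intro z hz
      simp only [Set.mem_iUnion, mem_disc] at hz
      obtain ⟨μ, hμ, w, hw, rfl⟩ := hz
      rw [mem_closedBall_zero_iff]
      exact (norm_add_le _ _).trans (add_le_add hμ (hd _ hw))
    have h := measure_mono (μ := volume) hsub
    rw [hV, Complex.volume_closedBall, ← ENNReal.ofReal_pow (by linarith)] at h
    rw [← ENNReal.ofReal_le_ofReal_iff (by positivity), mul_comm Real.pi,
      ENNReal.ofReal_mul (p := (R + d) ^ 2) (by positivity), ← NNReal.coe_real_pi, ENNReal.ofReal_coe_nnreal]
    exact h

theorem card_disc_sub_isBigO (τ : ℍ) :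
    (fun R : ℝ => ((disc τ R).card : ℝ) - Real.pi / ZLattice.covolume (lattice τ) * R ^ 2)
      =O[atTop] fun R : ℝ => R := by
  obtain ⟨d, hd0, hd⟩ := exists_card_disc_bounds τ
  have hV : 0 < ZLattice.covolume (lattice τ) := covolume_lattice_pos τ
  have hπ := Real.pi_pos
  generalize ZLattice.covolume (lattice τ) = V at *
  -- For d ≤ R, (R + d)² - R² = 2dR + d² ≤ 3dR.
  refine IsBigO.of_bound (Real.pi / V * (3 * d)) ?_
  filter_upwards [eventually_ge_atTop d, eventually_ge_atTop 0] with R hR hR0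
  obtain ⟨h1, h2⟩ := hd R hR
  rw [Real.norm_of_nonneg hR0, Real.norm_eq_abs]
  have key : |V * (disc τ R).card - Real.pi * R ^ 2|
      ≤ Real.pi * (3 * d) * R := by
    have : d ^ 2 ≤ d * R := by nlinarith
    rw [abs_le]
    constructor <;> nlinarith [mul_le_mul_of_nonneg_left this hπ.le, mul_nonneg hπ.le (sq_nonneg d)]
  calc |((disc τ R).card : ℝ) - Real.pi / V * R ^ 2|
      = |V * (disc τ R).card - Real.pi * R ^ 2| /
        V := by
        rw [← abs_of_pos hV, ← abs_div, abs_of_pos hV]; congr 1; field_simp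
    _ ≤ Real.pi * (3 * d) * R / V := by gcongr
    _ = _ := by ring

/-- There are `O(R)` lattice points in an annulus of fixed width around the circle of radius `R`. -/
theorem card_annulus_isBigO (τ : ℍ) (c : ℝ) :
    (fun R : ℝ => ((disc τ (R + c)).card : ℝ) - (disc τ (R - c)).card)
      =O[atTop] fun R : ℝ => R := by
  have hlin : ∀ c : ℝ, (fun R : ℝ => R + c) =O[atTop] fun R : ℝ => R := fun c =>
    (isBigO_refl _ _).add (isLittleO_const_id_atTop c).isBigO
  have h1 := ((card_disc_sub_isBigO τ).comp_tendsto
    (tendsto_atTop_add_const_right atTop c tendsto_id)).trans (hlin c)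
  have h2 := ((card_disc_sub_isBigO τ).comp_tendsto
    (tendsto_atTop_add_const_right atTop (-c) tendsto_id)).trans (hlin (-c))
  -- The main terms differ by (R + c)² - (R - c)² = 4cR.
  have h3 : (fun R : ℝ => Real.pi / ZLattice.covolume (lattice τ) * (4 * c) * R)
      =O[atTop] fun R : ℝ => R := isBigO_const_mul_self _ _ _
  refine ((h1.sub h2).add h3).congr_left fun R => ?_
  simp only [Function.comp, id, ← sub_eq_add_neg]
  ring

/-! ### Translated sums and character sums over discs -/

/-- Common terms cancel, and the symmetric difference of S and T lies in B \ A. -/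
theorem norm_sum_sub_sum_le {ι : Type*} [DecidableEq ι] {A B S T : Finset ι} (hAS : A ⊆ S)
    (hSB : S ⊆ B) (hAT : A ⊆ T) (hTB : T ⊆ B) (h : ι → ℂ) :
    ‖∑ i ∈ S, h i - ∑ i ∈ T, h i‖ ≤ ∑ i ∈ B \ A, ‖h i‖ := by
  have e : ∑ i ∈ S, h i - ∑ i ∈ T, h i = ∑ i ∈ S \ T, h i - ∑ i ∈ T \ S, h i := by
    rw [Finset.sum_sdiff_sub_sum_sdiff]
  rw [e]
  calc _ ≤ ‖∑ i ∈ S \ T, h i‖ + ‖∑ i ∈ T \ S, h i‖ := norm_sub_le _ _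
    _ ≤ ∑ i ∈ S \ T, ‖h i‖ + ∑ i ∈ T \ S, ‖h i‖ :=
      add_le_add (norm_sum_le _ _) (norm_sum_le _ _)
    _ = ∑ i ∈ S \ T ∪ T \ S, ‖h i‖ := by
      rw [Finset.sum_union (Finset.disjoint_left.mpr (by grind))]
    _ ≤ _ := Finset.sum_le_sum_of_subset_of_nonneg (by grind) fun _ _ _ => norm_nonneg _

/-- Translating the summand of a sum over a disc changes it by a sum over an annulus. -/
theorem norm_sum_disc_sub_translate_le (τ : ℍ) (h : lattice τ → ℂ) (ν : lattice τ) (R : ℝ) :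
    ‖∑ μ ∈ disc τ R, h μ - ∑ μ ∈ disc τ R, h (μ + ν)‖ ≤
      ∑ μ ∈ disc τ (R + ‖(ν : ℂ)‖) \ disc τ (R - ‖(ν : ℂ)‖), ‖h μ‖ := by
  classical
  have e : ∑ μ ∈ disc τ R, h (μ + ν) =
      ∑ μ ∈ (disc τ R).map (Equiv.addRight ν).toEmbedding, h μ := by simp
  have hν := norm_nonneg (ν : ℂ)
  rw [e]
  refine norm_sum_sub_sum_le (disc_mono τ (by linarith)) (disc_mono τ (by linarith)) ?_ ?_ h
  · intro μ hμ
    rw [mem_disc] at hμ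
    rw [Finset.mem_map]
    refine ⟨μ - ν, ?_, by simp⟩
    rw [mem_disc, AddSubgroupClass.coe_sub]
    linarith [norm_sub_le (μ : ℂ) (ν : ℂ)]
  · intro μ hμ
    rw [Finset.mem_map] at hμ
    obtain ⟨μ, hμ, rfl⟩ := hμ
    rw [mem_disc] at hμ
    rw [mem_disc]
    change ‖(μ : ℂ) + ν‖ ≤ _
    linarith [norm_add_le (μ : ℂ) (ν : ℂ)]

theorem card_disc_sdiff (τ : ℍ) {R S : ℝ} (h : R ≤ S) :
    ((disc τ S \ disc τ R).card : ℝ) = (disc τ S).card - (disc τ R).card := by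
  rw [Finset.card_sdiff_of_subset (disc_mono τ h), Nat.cast_sub (Finset.card_le_card (disc_mono τ h))]

/-- The sums of a nontrivial character over discs of radius `R` are `O(R)`. -/
theorem sum_disc_char_isBigO (τ : ℍ) {ψ : LatticeChar τ} (hψ : ψ ≠ 1) :
    (fun R : ℝ => ∑ μ ∈ disc τ R, (ψ μ : ℂ)) =O[atTop] fun R : ℝ => R := by
  obtain ⟨ν, hν⟩ : ∃ ν, ψ ν ≠ 1 := by
    by_contra! H
    exact hψ (by ext μ; simp [H μ])
  have hν' : (1 - (ψ ν : ℂ)) ≠ 0 := by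
    rw [sub_ne_zero]; exact fun H => hν (Circle.ext (by simpa using H.symm))
  -- Multiplication by ψ(ν) translates the summand by ν, so the product is a difference of two sums
  -- that agree off an annulus of fixed width.
  have h1 : (fun R : ℝ => (1 - (ψ ν : ℂ)) * ∑ μ ∈ disc τ R, (ψ μ : ℂ)) =O[atTop]
      fun R : ℝ => R := by
    refine IsBigO.trans ?_ (card_annulus_isBigO τ ‖(ν : ℂ)‖)
    refine IsBigO.of_bound 1 (Eventually.of_forall fun R => ?_)
    have hc := norm_nonneg (ν : ℂ)
    have e : (1 - (ψ ν : ℂ)) * ∑ μ ∈ disc τ R, (ψ μ : ℂ) =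
        ∑ μ ∈ disc τ R, (ψ μ : ℂ) - ∑ μ ∈ disc τ R, (ψ (μ + ν) : ℂ) := by
      simp only [AddChar.map_add_eq_mul, Circle.coe_mul, ← Finset.sum_mul]
      ring
    rw [e, one_mul, ← card_disc_sdiff τ (by linarith), Real.norm_natCast]
    refine (norm_sum_disc_sub_translate_le τ (fun μ => (ψ μ : ℂ)) ν R).trans ?_
    simp only [Circle.norm_coe]
    rw [Finset.sum_const, nsmul_one]
  have h2 := h1.const_mul_left (1 - (ψ ν : ℂ))⁻¹
  simpa only [inv_mul_cancel_left₀ hν'] using h2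

/-! ### Partial summation -/

/-- A function whose oscillation beyond `x` is `O(x^{-1/2})` converges, at this rate. -/
theorem exists_limit_of_oscillation_le {W : ℝ → ℂ} {C x₀ : ℝ} (hx₀ : 0 < x₀)
    (h : ∀ x y, x₀ ≤ x → x ≤ y → ‖W y - W x‖ ≤ C * x ^ (-(1 / 2) : ℝ)) :
    ∃ l : ℂ, (fun x => W x - l) =O[atTop] fun x : ℝ => x ^ (-(1 / 2) : ℝ) := by
  have hlim : Tendsto (fun x : ℝ => C * x ^ (-(1 / 2) : ℝ)) atTop (𝓝 0) := by
    simpa using (tendsto_rpow_neg_atTop (by norm_num : (0 : ℝ) < 1 / 2)).const_mul C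
  have hW : CauchySeq W := by
    rw [Metric.cauchySeq_iff']
    intro ε hε
    obtain ⟨x, hx, hx'⟩ := ((hlim.eventually (gt_mem_nhds hε)).and (eventually_ge_atTop x₀)).exists
    exact ⟨x, fun y hy => by rw [dist_eq_norm]; exact (h x y hx' hy).trans_lt hx⟩
  obtain ⟨l, hl⟩ := cauchySeq_tendsto_of_complete hW
  refine ⟨l, IsBigO.of_bound C ?_⟩
  filter_upwards [eventually_ge_atTop x₀] with x hx
  have h0 : 0 ≤ x ^ (-(1 / 2) : ℝ) := Real.rpow_nonneg (hx₀.le.trans hx) _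
  rw [Real.norm_of_nonneg h0, norm_sub_rev]
  refine le_of_tendsto (hl.sub_const (W x)).norm ?_
  filter_upwards [eventually_ge_atTop x] with y hy using h x y hx hy

theorem integrableOn_inv_sq {x y : ℝ} (hx : 0 < x) (hxy : x ≤ y) :
    IntervalIntegrable (fun t : ℝ => (t ^ 2)⁻¹) volume x y := by
  refine ContinuousOn.intervalIntegrable (ContinuousOn.inv₀ (by fun_prop) fun t ht => ?_)
  rw [Set.uIcc_of_le hxy] at ht
  have := hx.trans_le ht.1
  positivity

theorem integral_inv_sq {x y : ℝ} (hx : 0 < x) (hxy : x ≤ y) :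
    ∫ t in x..y, (t ^ 2)⁻¹ = 1 / x - 1 / y := by
  have h : ∀ t ∈ Set.uIcc x y, HasDerivAt (fun t : ℝ => -t⁻¹) ((t ^ 2)⁻¹) t := fun t ht => by
    rw [Set.uIcc_of_le hxy] at ht
    simpa using! (hasDerivAt_inv (hx.trans_le ht.1).ne').neg
  rw [intervalIntegral.integral_eq_sub_of_hasDerivAt h (integrableOn_inv_sq hx hxy)]
  ring

theorem intervalIntegrable_step_inv_sq {x y : ℝ} (hx : 0 < x) (hxy : x ≤ y) (a : ℝ) :
    IntervalIntegrable (fun t : ℝ => if a ≤ t then (t ^ 2)⁻¹ else 0) volume x y := by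
  have h := integrableOn_inv_sq hx hxy
  rw [intervalIntegrable_iff] at h ⊢
  exact IntegrableOn.congr_fun (Integrable.indicator h (measurableSet_Ici (a := a)))
    (fun t _ => by simp [Set.indicator_apply]) measurableSet_uIoc

theorem integral_step_inv_sq {a x y : ℝ} (hx : 0 < x) (hxy : x ≤ y) (hay : a ≤ y) :
    ∫ t in x..y, (if a ≤ t then (t ^ 2)⁻¹ else 0) = 1 / max a x - 1 / y := by
  have hm : 0 < max a x := lt_max_of_lt_right hx
  rw [← intervalIntegral.integral_add_adjacent_intervals
    (b := max a x) (intervalIntegrable_step_inv_sq hx (le_max_right _ _) a)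
    (intervalIntegrable_step_inv_sq hm (max_le hay hxy) a)]
  have h1 : ∫ t in x..max a x, (if a ≤ t then (t ^ 2)⁻¹ else 0) = 0 := by
    rcases le_total a x with h | h
    · rw [max_eq_right h, intervalIntegral.integral_same]
    · rw [max_eq_left h]
      refine intervalIntegral.integral_zero_ae ?_
      filter_upwards [Measure.ae_ne volume a] with t hta ht
      rw [Set.uIoc_of_le h] at ht
      exact if_neg fun hat => hta (le_antisymm ht.2 hat)
  have h2 : ∫ t in max a x..y, (if a ≤ t then (t ^ 2)⁻¹ else 0) = ∫ t in max a x..y, (t ^ 2)⁻¹ := by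
    refine intervalIntegral.integral_congr fun t ht => ?_
    rw [Set.uIcc_of_le (max_le hay hxy)] at ht
    exact if_pos ((le_max_left _ _).trans ht.1)
  rw [h1, h2, integral_inv_sq hm (max_le hay hxy), zero_add]

/-- The nonzero `μ ∈ Λ` with `|μ|² ≤ x`. -/
noncomputable abbrev puncturedDisc (τ : ℍ) (x : ℝ) : Finset (lattice τ) :=
  (finite_punctured_disc τ x).toFinset

theorem mem_puncturedDisc {τ : ℍ} {x : ℝ} {μ : lattice τ} :
    μ ∈ puncturedDisc τ x ↔ μ ≠ 0 ∧ ‖(μ : ℂ)‖ ^ 2 ≤ x := by simp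

theorem puncturedDisc_eq (τ : ℍ) {x : ℝ} (hx : 0 ≤ x) [DecidableEq (lattice τ)] :
    puncturedDisc τ x = (disc τ (√x)).erase 0 := by
  ext μ
  rw [mem_puncturedDisc, Finset.mem_erase, mem_disc, Real.le_sqrt (norm_nonneg _) hx]

theorem puncturedDisc_eq_filter (τ : ℍ) {t y : ℝ} (ht : t ≤ y) :
    puncturedDisc τ t = {μ ∈ puncturedDisc τ y | ‖((μ : lattice τ) : ℂ)‖ ^ 2 ≤ t} := by
  ext μ
  simp only [Finset.mem_filter, mem_puncturedDisc]
  exact ⟨fun h => ⟨⟨h.1, h.2.trans ht⟩, h.2⟩, fun h => ⟨h.1.1, h.2⟩⟩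

/-- A range of summation depending on t is traded for step functions over a fixed finite set, so
that integrability and the integral can be treated term by term. -/
theorem sum_puncturedDisc_mul_eqOn (τ : ℍ) (f : lattice τ → ℂ) {x y : ℝ} (hxy : x ≤ y) :
    Set.EqOn (fun t => (∑ μ ∈ puncturedDisc τ t, f μ) * (((t ^ 2)⁻¹ : ℝ) : ℂ))
      (fun t => ∑ μ ∈ puncturedDisc τ y, f μ *
        ((if ‖(μ : ℂ)‖ ^ 2 ≤ t then (t ^ 2)⁻¹ else 0 : ℝ) : ℂ)) (Set.uIcc x y) := by
  intro t ht
  rw [Set.uIcc_of_le hxy] at ht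
  simp only
  rw [puncturedDisc_eq_filter τ ht.2, Finset.sum_filter, Finset.sum_mul]
  refine Finset.sum_congr rfl fun μ _ => ?_
  split_ifs <;> simp

theorem intervalIntegrable_mul_step_inv_sq {x y : ℝ} (hx : 0 < x) (hxy : x ≤ y) (a : ℝ) (c : ℂ) :
    IntervalIntegrable (fun t : ℝ => c * ((if a ≤ t then (t ^ 2)⁻¹ else 0 : ℝ) : ℂ))
      volume x y := by
  refine IntervalIntegrable.const_mul ?_ c
  have h := intervalIntegrable_step_inv_sq hx hxy a
  rw [intervalIntegrable_iff] at h ⊢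
  exact Integrable.ofReal h

theorem intervalIntegrable_sum_puncturedDisc_mul (τ : ℍ) (f : lattice τ → ℂ) {x y : ℝ}
    (hx : 0 < x) (hxy : x ≤ y) :
    IntervalIntegrable (fun t => (∑ μ ∈ puncturedDisc τ t, f μ) * (((t ^ 2)⁻¹ : ℝ) : ℂ))
      volume x y := by
  refine IntervalIntegrable.congr
    (((sum_puncturedDisc_mul_eqOn τ f hxy).symm).mono Set.uIoc_subset_uIcc) ?_
  have h := IntervalIntegrable.sum (μ := volume) (a := x) (b := y) (puncturedDisc τ y)
    (f := fun μ t => f μ * ((if ‖(μ : ℂ)‖ ^ 2 ≤ t then (t ^ 2)⁻¹ else 0 : ℝ) : ℂ))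
    fun μ _ => intervalIntegrable_mul_step_inv_sq hx hxy _ (f μ)
  convert! h using 1
  ext t
  rw [Finset.sum_apply]

/-- Summation by parts over the lattice points in an annulus. -/
theorem sum_div_normSq_sub (τ : ℍ) (f : lattice τ → ℂ) {x y : ℝ} (hx : 0 < x) (hxy : x ≤ y) :
    ∑ μ ∈ puncturedDisc τ y, f μ / ((‖(μ : ℂ)‖ ^ 2 : ℝ) : ℂ) -
      ∑ μ ∈ puncturedDisc τ x, f μ / ((‖(μ : ℂ)‖ ^ 2 : ℝ) : ℂ) =
    (∑ μ ∈ puncturedDisc τ y, f μ) / y - (∑ μ ∈ puncturedDisc τ x, f μ) / x +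
      ∫ t in x..y, (∑ μ ∈ puncturedDisc τ t, f μ) * (((t ^ 2)⁻¹ : ℝ) : ℂ) := by
  have hint : ∫ t in x..y, (∑ μ ∈ puncturedDisc τ t, f μ) * (((t ^ 2)⁻¹ : ℝ) : ℂ) =
      ∑ μ ∈ puncturedDisc τ y, f μ * ((1 / max (‖(μ : ℂ)‖ ^ 2) x - 1 / y : ℝ) : ℂ) := by
    rw [intervalIntegral.integral_congr (sum_puncturedDisc_mul_eqOn τ f hxy),
      intervalIntegral.integral_finsetSum]
    · refine Finset.sum_congr rfl fun μ hμ => ?_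
      rw [intervalIntegral.integral_const_mul, intervalIntegral.integral_ofReal,
        integral_step_inv_sq hx hxy (mem_puncturedDisc.mp hμ).2]
    · exact fun μ _ => intervalIntegrable_mul_step_inv_sq hx hxy _ (f μ)
  rw [hint, puncturedDisc_eq_filter τ hxy, Finset.sum_filter, Finset.sum_filter, Finset.sum_div, Finset.sum_div,
    ← Finset.sum_sub_distrib, ← Finset.sum_sub_distrib, ← Finset.sum_add_distrib]
  refine Finset.sum_congr rfl fun μ hμ => ?_
  have hy : (y : ℂ) ≠ 0 := by exact_mod_cast (hx.trans_le hxy).ne'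
  have hx' : (x : ℂ) ≠ 0 := by exact_mod_cast hx.ne'
  split_ifs with h
  · rw [max_eq_right h]; push_cast; field_simp; ring
  · rw [max_eq_left (not_le.mp h).le]; push_cast; field_simp; ring

/-- Partial summation: a lattice sum weighted by `|μ|⁻²`, from an estimate of the
unweighted one. -/
theorem exists_sum_div_normSq_isBigO (τ : ℍ) (f : lattice τ → ℂ) (A : ℝ)
    (h : (fun t : ℝ => ∑ μ ∈ puncturedDisc τ t, f μ - A * t) =O[atTop] fun t : ℝ => √t) :
    ∃ l : ℂ, (fun x : ℝ => ∑ μ ∈ puncturedDisc τ x, f μ / ((‖(μ : ℂ)‖ ^ 2 : ℝ) : ℂ) -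
      (A * Real.log x : ℝ) - l) =O[atTop] fun x : ℝ => x ^ (-(1 / 2) : ℝ) := by
  obtain ⟨K, hK⟩ := h.bound
  obtain ⟨x₁, hx₁⟩ := eventually_atTop.mp hK
  set x₀ := max x₁ 1
  have hx₀ : 0 < x₀ := lt_max_of_lt_right one_pos
  set D : ℝ → ℂ := fun t => ∑ μ ∈ puncturedDisc τ t, f μ - A * t with hD
  have hK' : ∀ t, x₀ ≤ t → ‖D t‖ ≤ K * √t := fun t ht => by
    simpa [Real.norm_of_nonneg (Real.sqrt_nonneg t)] using hx₁ t ((le_max_left _ _).trans ht)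
  have hK0 : 0 ≤ K := by
    have := (norm_nonneg _).trans (hK' x₀ le_rfl)
    exact nonneg_of_mul_nonneg_left this (Real.sqrt_pos.mpr hx₀)
  -- The boundary terms at x and y contribute K each, and the integral of K t^(-3/2) contributes 2K.
  refine exists_limit_of_oscillation_le (C := 4 * K) hx₀ fun x y hx hxy => ?_
  have hx0 : 0 < x := hx₀.trans_le hx
  have hy0 : 0 < y := hx0.trans_le hxy
  have hpow : ∀ t : ℝ, 0 < t → √t / t = t ^ (-(1 / 2) : ℝ) := fun t ht => by
    rw [Real.sqrt_eq_rpow, ← Real.rpow_sub_one ht.ne']; norm_num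
  have hD1 : ∀ t, x ≤ t → ‖D t / t‖ ≤ K * t ^ (-(1 / 2) : ℝ) := fun t ht => by
    have ht0 := hx0.trans_le ht
    rw [norm_div, Complex.norm_real, Real.norm_of_nonneg ht0.le, ← hpow t ht0, ← mul_div_assoc]
    gcongr
    exact hK' t (hx.trans ht)
  have hint : ∫ t in x..y, (∑ μ ∈ puncturedDisc τ t, f μ) * (((t ^ 2)⁻¹ : ℝ) : ℂ) =
      (∫ t in x..y, D t * (((t ^ 2)⁻¹ : ℝ) : ℂ)) + (A * (Real.log y - Real.log x) : ℝ) := by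
    have e : ∀ t ∈ Set.uIcc x y, D t * (((t ^ 2)⁻¹ : ℝ) : ℂ) =
        (∑ μ ∈ puncturedDisc τ t, f μ) * (((t ^ 2)⁻¹ : ℝ) : ℂ) - ((A * t⁻¹ : ℝ) : ℂ) := by
      intro t ht
      rw [Set.uIcc_of_le hxy] at ht
      have : (t : ℂ) ≠ 0 := by exact_mod_cast (hx0.trans_le ht.1).ne'
      simp only [hD]
      push_cast
      field_simp
    have hinv : IntervalIntegrable (fun t : ℝ => ((A * t⁻¹ : ℝ) : ℂ)) volume x y := by
      refine ContinuousOn.intervalIntegrable (Complex.continuous_ofReal.comp_continuousOn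
        (continuousOn_const.mul (ContinuousOn.inv₀ continuousOn_id fun t ht => ?_)))
      rw [Set.uIcc_of_le hxy] at ht
      exact (hx0.trans_le ht.1).ne'
    rw [intervalIntegral.integral_congr e, intervalIntegral.integral_sub
      (intervalIntegrable_sum_puncturedDisc_mul τ f hx0 hxy) hinv,
      intervalIntegral.integral_ofReal, intervalIntegral.integral_const_mul,
      integral_inv_of_pos hx0 hy0, Real.log_div hy0.ne' hx0.ne']
    ring
  have hbound : ‖∫ t in x..y, D t * (((t ^ 2)⁻¹ : ℝ) : ℂ)‖ ≤ 2 * K * x ^ (-(1 / 2) : ℝ) := by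
    have h32 : ∫ t in x..y, K * t ^ (-(3 / 2) : ℝ) =
        2 * K * (x ^ (-(1 / 2) : ℝ) - y ^ (-(1 / 2) : ℝ)) := by
      rw [intervalIntegral.integral_const_mul, integral_rpow]
      · norm_num; ring
      · right
        refine ⟨by norm_num, ?_⟩
        rw [Set.uIcc_of_le hxy]
        exact fun h => absurd h.1 (not_le.mpr hx0)
    have hle := intervalIntegral.norm_integral_le_of_norm_le (μ := volume)
      (f := fun t => D t * (((t ^ 2)⁻¹ : ℝ) : ℂ)) (g := fun t => K * t ^ (-(3 / 2) : ℝ)) hxy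
      (Eventually.of_forall fun t ht => ?_) ?_
    · rw [h32] at hle
      have := Real.rpow_nonneg hy0.le (-(1 / 2) : ℝ)
      nlinarith
    · have ht0 : 0 < t := hx0.trans ht.1
      have e1 : t ^ (-(3 / 2) : ℝ) = √t * (t ^ 2)⁻¹ := by
        rw [Real.sqrt_eq_rpow, ← Real.rpow_natCast, ← Real.rpow_neg ht0.le, ← Real.rpow_add ht0]
        norm_num
      rw [norm_mul, Complex.norm_real, Real.norm_of_nonneg (by positivity), e1, ← mul_assoc]
      gcongr
      exact hK' t (hx.trans ht.1.le)
    · refine (ContinuousOn.intervalIntegrable ?_)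
      rw [Set.uIcc_of_le hxy]
      exact continuousOn_const.mul (ContinuousOn.rpow_const continuousOn_id fun t ht =>
        Or.inl (hx0.trans_le ht.1).ne')
  -- The linear main term A·t cancels between the two boundary quotients; in the integral it becomes
  -- the logarithm that is subtracted.
  have hmain : (∑ μ ∈ puncturedDisc τ y, f μ / ((‖(μ : ℂ)‖ ^ 2 : ℝ) : ℂ) -
      (A * Real.log y : ℝ)) - (∑ μ ∈ puncturedDisc τ x, f μ / ((‖(μ : ℂ)‖ ^ 2 : ℝ) : ℂ) -
      (A * Real.log x : ℝ)) =
      D y / y - D x / x + ∫ t in x..y, D t * (((t ^ 2)⁻¹ : ℝ) : ℂ) := by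
    have hyc : (y : ℂ) ≠ 0 := by exact_mod_cast hy0.ne'
    have hxc : (x : ℂ) ≠ 0 := by exact_mod_cast hx0.ne'
    have h := sum_div_normSq_sub τ f hx0 hxy
    rw [hint] at h
    simp only [hD] at h ⊢
    rw [sub_div, sub_div, mul_div_cancel_right₀ _ hyc, mul_div_cancel_right₀ _ hxc]
    push_cast at h ⊢
    linear_combination h
  rw [hmain]
  have hmono : y ^ (-(1 / 2) : ℝ) ≤ x ^ (-(1 / 2) : ℝ) :=
    Real.rpow_le_rpow_of_nonpos hx0 hxy (by norm_num)
  calc _ ≤ ‖D y / y‖ + ‖D x / x‖ + ‖∫ t in x..y, D t * (((t ^ 2)⁻¹ : ℝ) : ℂ)‖ :=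
        (norm_add_le _ _).trans (by gcongr; exact norm_sub_le _ _)
    _ ≤ K * y ^ (-(1 / 2) : ℝ) + K * x ^ (-(1 / 2) : ℝ) + 2 * K * x ^ (-(1 / 2) : ℝ) :=
        add_le_add (add_le_add (hD1 y hxy) (hD1 x le_rfl)) hbound
    _ ≤ K * x ^ (-(1 / 2) : ℝ) + K * x ^ (-(1 / 2) : ℝ) + 2 * K * x ^ (-(1 / 2) : ℝ) := by gcongr
    _ = _ := by ring

/-! ### Asymptotics of Z -/

theorem Z_eq_sum (τ : ℍ) (ψ : LatticeChar τ) (x : ℝ) :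
    Z τ ψ x = ∑ μ ∈ puncturedDisc τ x, (ψ μ : ℂ) / ((‖(μ : ℂ)‖ ^ 2 : ℝ) : ℂ) := rfl

theorem sum_puncturedDisc (τ : ℍ) (f : lattice τ → ℂ) {t : ℝ} (ht : 0 ≤ t) :
    ∑ μ ∈ puncturedDisc τ t, f μ = ∑ μ ∈ disc τ (√t), f μ - f 0 := by
  classical
  rw [puncturedDisc_eq τ ht, eq_sub_iff_add_eq]
  exact Finset.sum_erase_add _ _ (by rw [mem_disc]; simp)

theorem isBigO_const_sqrt (c : ℂ) : (fun _ : ℝ => c) =O[atTop] fun t : ℝ => √t :=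
  ((isLittleO_const_id_atTop c).isBigO).comp_tendsto Real.tendsto_sqrt_atTop

theorem Z_one_asymptotic (τ : ℍ) : ∃ η : ℝ, (fun x : ℝ => Z τ 1 x -
      ((Real.pi / ZLattice.covolume (lattice τ) * (Real.log x + η) : ℝ) : ℂ))
    =O[atTop] fun x : ℝ => x ^ (-(1 / 2) : ℝ) := by
  have hV := covolume_lattice_pos τ
  have hS : (fun t : ℝ => ∑ μ ∈ puncturedDisc τ t, ((1 : LatticeChar τ) μ : ℂ) -
      (Real.pi / ZLattice.covolume (lattice τ) : ℝ) * t) =O[atTop] fun t : ℝ => √t := by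
    have h1 := (card_disc_sub_isBigO τ).comp_tendsto Real.tendsto_sqrt_atTop
    have h2 := (Complex.isBigO_ofReal_left.mpr h1).sub (isBigO_const_sqrt 1)
    refine h2.congr' ?_ EventuallyEq.rfl
    filter_upwards [eventually_ge_atTop 0] with t ht
    rw [sum_puncturedDisc τ _ ht]
    simp only [Function.comp, Real.sq_sqrt ht, AddChar.one_apply, Circle.coe_one]
    rw [Finset.sum_const, nsmul_one]
    push_cast
    ring
  obtain ⟨l, hl⟩ := exists_sum_div_normSq_isBigO τ _ _ hS
  -- Partial summation yields a complex constant l. As Z(x, Λ, 1) is real, replacing l by its real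
  -- part does not increase the error.
  refine ⟨l.re * (ZLattice.covolume (lattice τ) / Real.pi), ?_⟩
  refine IsBigO.trans (IsBigO.of_bound 1 (Eventually.of_forall fun x => ?_)) hl
  have hreal : Z τ 1 x = ((∑ μ ∈ puncturedDisc τ x, 1 / ‖(μ : ℂ)‖ ^ 2 : ℝ) : ℂ) := by
    rw [Z_eq_sum]
    push_cast
    simp
  rw [one_mul, ← Z_eq_sum, hreal]
  generalize ZLattice.covolume (lattice τ) = V at *
  have hπ := Real.pi_pos
  rw [← Complex.ofReal_sub, ← Complex.ofReal_sub, Complex.norm_real, Real.norm_eq_abs]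
  refine le_trans (le_of_eq ?_) (Complex.abs_re_le_norm _)
  rw [Complex.sub_re, Complex.ofReal_re]
  congr 1
  field_simp
  ring

theorem exists_Z_limit (τ : ℍ) {ψ : LatticeChar τ} (hψ : ψ ≠ 1) :
    ∃ l : ℂ, (fun x : ℝ => Z τ ψ x - l) =O[atTop] fun x : ℝ => x ^ (-(1 / 2) : ℝ) := by
  have hS : (fun t : ℝ => ∑ μ ∈ puncturedDisc τ t, (ψ μ : ℂ) - (0 : ℝ) * t) =O[atTop]
      fun t : ℝ => √t := by
    have h1 := (sum_disc_char_isBigO τ hψ).comp_tendsto Real.tendsto_sqrt_atTop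
    refine (h1.sub (isBigO_const_sqrt (ψ 0))).congr' ?_ EventuallyEq.rfl
    filter_upwards [eventually_ge_atTop 0] with t ht
    rw [sum_puncturedDisc τ _ ht]
    simp
  obtain ⟨l, hl⟩ := exists_sum_div_normSq_isBigO τ _ _ hS
  exact ⟨l, by simpa [Z_eq_sum] using hl⟩

theorem tendsto_of_sub_isBigO {W : ℝ → ℂ} {l : ℂ}
    (h : (fun x => W x - l) =O[atTop] fun x : ℝ => x ^ (-(1 / 2) : ℝ)) :
    Tendsto W atTop (𝓝 l) :=
  tendsto_sub_nhds_zero_iff.mp (h.trans_tendsto (tendsto_rpow_neg_atTop (by norm_num)))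

theorem Z_tendsto_L (τ : ℍ) {ψ : LatticeChar τ} (hψ : ψ ≠ 1) :
    Tendsto (Z τ ψ) atTop (𝓝 (L τ ψ)) := by
  obtain ⟨l, hl⟩ := exists_Z_limit τ hψ
  have h := tendsto_of_sub_isBigO hl
  rwa [← h.limUnder_eq] at h

theorem Z_sub_L_isBigO (τ : ℍ) {ψ : LatticeChar τ} (hψ : ψ ≠ 1) :
    (fun x : ℝ => Z τ ψ x - L τ ψ) =O[atTop] fun x : ℝ => x ^ (-(1 / 2) : ℝ) := by
  obtain ⟨l, hl⟩ := exists_Z_limit τ hψ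
  rwa [← (tendsto_of_sub_isBigO hl).limUnder_eq] at hl

/-! ### L as an absolutely convergent sum -/

/-- The summand `ψ(μ) / |μ|²`, with value `0` at `μ = 0`. -/
noncomputable def term (τ : ℍ) (ψ : LatticeChar τ) (μ : lattice τ) : ℂ :=
  (ψ μ : ℂ) / ((‖(μ : ℂ)‖ ^ 2 : ℝ) : ℂ)

theorem norm_term (τ : ℍ) (ψ : LatticeChar τ) (μ : lattice τ) :
    ‖term τ ψ μ‖ = (‖(μ : ℂ)‖ ^ 2)⁻¹ := by
  rw [term, norm_div, Circle.norm_coe, Complex.norm_real,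
    Real.norm_of_nonneg (by positivity), one_div]

theorem sum_disc_term (τ : ℍ) (ψ : LatticeChar τ) {R : ℝ} (hR : 0 ≤ R) :
    ∑ μ ∈ disc τ R, term τ ψ μ = Z τ ψ (R ^ 2) := by
  have h := sum_puncturedDisc τ (term τ ψ) (sq_nonneg R)
  rw [Real.sqrt_sq hR] at h
  have h0 : term τ ψ 0 = 0 := by simp [term]
  rw [h0, sub_zero] at h
  exact h.symm

/-- The boundary terms that arise from translating the summation disc are negligible. -/
theorem tendsto_sum_disc_term_translate_sub (τ : ℍ) (ψ : LatticeChar τ) (ν : lattice τ) :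
    Tendsto (fun R : ℝ => ∑ μ ∈ disc τ R, term τ ψ μ - ∑ μ ∈ disc τ R, term τ ψ (μ + ν))
      atTop (𝓝 0) := by
  set c := ‖(ν : ℂ)‖ with hc
  have hc0 : 0 ≤ c := norm_nonneg _
  have hsub : Tendsto (fun R : ℝ => R - c) atTop atTop :=
    tendsto_atTop_add_const_right atTop (-c) tendsto_id
  -- The annulus has O(R) points, each contributing at most (R - c)⁻², so the total is O(1/R).
  have hlim : Tendsto (fun R : ℝ => (((disc τ (R + c)).card : ℝ) - (disc τ (R - c)).card) *
      ((R - c) ^ 2)⁻¹) atTop (𝓝 0) := by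
    have h1 : (fun R : ℝ => R) =O[atTop] fun R : ℝ => R - c := by
      have h : (fun R : ℝ => (R - c) + c) =O[atTop] fun R : ℝ => R - c :=
        (isBigO_refl _ _).add ((isLittleO_const_id_atTop c).isBigO.comp_tendsto hsub)
      simpa using h
    have h2 := ((card_annulus_isBigO τ c).trans h1).mul
      (isBigO_refl (fun R : ℝ => ((R - c) ^ 2)⁻¹) atTop)
    refine h2.trans_tendsto ((tendsto_inv_atTop_zero.comp hsub).congr' ?_)
    filter_upwards [eventually_gt_atTop c] with R hR
    have : R - c ≠ 0 := by linarith
    simp only [Function.comp]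
    field_simp
  refine squeeze_zero_norm' ?_ hlim
  filter_upwards [eventually_gt_atTop c] with R hR
  refine (norm_sum_disc_sub_translate_le τ (term τ ψ) ν R).trans ?_
  rw [← card_disc_sdiff τ (by linarith), ← nsmul_eq_mul]
  refine Finset.sum_le_card_nsmul _ _ _ fun μ hμ => ?_
  rw [Finset.mem_sdiff, mem_disc, mem_disc, not_le] at hμ
  rw [norm_term]
  have : 0 < R - c := by linarith
  have := hμ.2.le
  gcongr

/-- Differencing gains one power of decay. The mixed products in the factorization are bounded by
the inverse cube of the smaller number; keeping both cubes avoids deciding which that is. -/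
theorem abs_inv_sq_sub_inv_sq_le {a b c : ℝ} (ha : 0 < a) (hb : 0 < b) (h : |a - b| ≤ c) :
    |(a ^ 2)⁻¹ - (b ^ 2)⁻¹| ≤ 2 * c * ((a ^ 3)⁻¹ + (b ^ 3)⁻¹) := by
  have hc : 0 ≤ c := (abs_nonneg _).trans h
  have e : (a ^ 2)⁻¹ - (b ^ 2)⁻¹ = (b - a) * ((a * b ^ 2)⁻¹ + (a ^ 2 * b)⁻¹) := by
    field_simp; ring
  have h1 : (a * b ^ 2)⁻¹ ≤ (a ^ 3)⁻¹ + (b ^ 3)⁻¹ := by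
    rcases le_total a b with hab | hab
    · have : (a * b ^ 2)⁻¹ ≤ (a ^ 3)⁻¹ := by
        rw [show a ^ 3 = a * a ^ 2 by ring]; gcongr
      have : 0 < (b ^ 3)⁻¹ := by positivity
      linarith
    · have : (a * b ^ 2)⁻¹ ≤ (b ^ 3)⁻¹ := by
        rw [show b ^ 3 = b * b ^ 2 by ring]; gcongr
      have : 0 < (a ^ 3)⁻¹ := by positivity
      linarith
  have h2 : (a ^ 2 * b)⁻¹ ≤ (a ^ 3)⁻¹ + (b ^ 3)⁻¹ := by
    rcases le_total a b with hab | hab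
    · have : (a ^ 2 * b)⁻¹ ≤ (a ^ 3)⁻¹ := by
        rw [show a ^ 3 = a ^ 2 * a by ring]; gcongr
      have : 0 < (b ^ 3)⁻¹ := by positivity
      linarith
    · have : (a ^ 2 * b)⁻¹ ≤ (b ^ 3)⁻¹ := by
        rw [show b ^ 3 = b ^ 2 * b by ring]; gcongr
      have : 0 < (a ^ 3)⁻¹ := by positivity
      linarith
  rw [e, abs_mul, abs_sub_comm, abs_of_pos (by positivity : 0 < (a * b ^ 2)⁻¹ + (a ^ 2 * b)⁻¹)]
  calc _ ≤ c * (((a ^ 3)⁻¹ + (b ^ 3)⁻¹) + ((a ^ 3)⁻¹ + (b ^ 3)⁻¹)) := by gcongr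
    _ = _ := by ring

/-- Since ψ(ν)ψ(μ - ν) = ψ(μ), the character factors out and leaves a difference of inverse squares,
of cubic decay, which is summable over a lattice of rank 2. -/
theorem summable_term_sub (τ : ℍ) (ψ : LatticeChar τ) (ν : lattice τ) :
    Summable fun μ => term τ ψ μ - (ψ ν : ℂ) * term τ ψ (μ - ν) := by
  have hfin : Module.finrank ℤ (lattice τ) < 3 := by
    rw [PeriodPair.finrank_lattice]; norm_num
  have hs := ((ZLattice.summable_norm_pow_inv (lattice τ) 3 hfin).add
    (ZLattice.summable_norm_sub_inv_pow (lattice τ) 3 hfin (ν : ℂ))).mul_left (2 * ‖(ν : ℂ)‖)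
  refine Summable.of_norm_bounded_eventually hs ?_
  -- At 0 and ν one of the inverse squares takes the default value 0, so the estimate is claimed
  -- only away from them.
  have hf : ({0, ν} : Set (lattice τ)).Finite := by simp
  filter_upwards [hf.compl_mem_cofinite] with μ hμ
  simp only [Set.mem_compl_iff, Set.mem_insert_iff, Set.mem_singleton_iff, not_or] at hμ
  have h1 : 0 < ‖(μ : ℂ)‖ := by simpa using hμ.1
  have h2 : 0 < ‖(μ : ℂ) - ν‖ := by
    rw [norm_pos_iff, sub_ne_zero]; exact fun h => hμ.2 (Subtype.ext h)
  have hchar : (ψ ν : ℂ) * ψ (μ - ν) = ψ μ := by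
    rw [← Circle.coe_mul, ← AddChar.map_add_eq_mul, add_sub_cancel]
  have e : term τ ψ μ - (ψ ν : ℂ) * term τ ψ (μ - ν) =
      (ψ μ : ℂ) * (((‖(μ : ℂ)‖ ^ 2)⁻¹ - (‖(μ : ℂ) - ν‖ ^ 2)⁻¹ : ℝ) : ℂ) := by
    rw [term, term, AddSubgroupClass.coe_sub, ← hchar]
    push_cast
    ring
  rw [e, norm_mul, Circle.norm_coe, one_mul, Complex.norm_real, Real.norm_eq_abs]
  refine (abs_inv_sq_sub_inv_sq_le h1 h2 (c := ‖(ν : ℂ)‖) ?_).trans (le_of_eq (by simp))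
  simpa using abs_norm_sub_norm_le (μ : ℂ) ((μ : ℂ) - ν)

/-- The limit of `Z(x, Λ, ψ)` as an absolutely convergent sum. -/
theorem hasSum_term_sub (τ : ℍ) {ψ : LatticeChar τ} (hψ : ψ ≠ 1) (ν : lattice τ) :
    HasSum (fun μ => term τ ψ μ - (ψ ν : ℂ) * term τ ψ (μ - ν))
      ((1 - (ψ ν : ℂ)) * L τ ψ) := by
  have hs := (summable_term_sub τ ψ ν).hasSum
  have hdisc : Tendsto (disc τ) atTop atTop :=
    tendsto_atTop_finset_of_monotone (disc_mono τ) fun μ => ⟨‖(μ : ℂ)‖, by rw [mem_disc]⟩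
  have hlim := hs.comp hdisc
  have hZ : Tendsto (fun R : ℝ => ∑ μ ∈ disc τ R, term τ ψ μ) atTop (𝓝 (L τ ψ)) := by
    refine ((Z_tendsto_L τ hψ).comp (tendsto_pow_atTop two_ne_zero)).congr' ?_
    filter_upwards [eventually_ge_atTop 0] with R hR using (sum_disc_term τ ψ hR).symm
  have h2 := (hZ.const_mul (1 - (ψ ν : ℂ))).add
    ((tendsto_sum_disc_term_translate_sub τ ψ (-ν)).const_mul (ψ ν : ℂ))
  rw [mul_zero, add_zero] at h2
  rwa [tendsto_nhds_unique (h2.congr fun R => ?_) hlim]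
  simp only [Function.comp]
  rw [Finset.sum_sub_distrib, ← Finset.mul_sum]
  simp only [sub_eq_add_neg]
  ring

/-! ### Summation by rows -/

/-- The lattice point `mτ + n`. -/
noncomputable def point (τ : ℍ) (m n : ℤ) : lattice τ := (periods τ).latticeEquivProd.symm (n, m)

theorem coe_point (τ : ℍ) (m n : ℤ) : (point τ m n : ℂ) = m * τ + n := by
  rw [point, PeriodPair.latticeEquiv_symm_apply]
  simp [periods, add_comm]

theorem point_eq (τ : ℍ) (m n : ℤ) : point τ m n = m • gen τ + n • one τ := by
  refine Subtype.ext ?_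
  rw [coe_point]
  simp [gen, one]

theorem char_point (τ : ℍ) (ψ : LatticeChar τ) (m n : ℤ) :
    (ψ (point τ m n) : ℂ) = (ψ (gen τ) : ℂ) ^ m * (ψ (one τ) : ℂ) ^ n := by
  rw [point_eq, AddChar.map_add_eq_mul, AddChar.map_zsmul_eq_zpow, AddChar.map_zsmul_eq_zpow,
    Circle.coe_mul, Circle.coe_zpow, Circle.coe_zpow]

/-- The lattice points as pairs of integers `(m, n)`. -/
noncomputable def pointEquiv (τ : ℍ) : ℤ × ℤ ≃ lattice τ :=
  (Equiv.prodComm ℤ ℤ).trans (periods τ).latticeEquivProd.symm.toEquiv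

theorem pointEquiv_apply (τ : ℍ) (p : ℤ × ℤ) : pointEquiv τ p = point τ p.1 p.2 := rfl

theorem norm_term_point (τ : ℍ) (ψ : LatticeChar τ) (m n : ℤ) :
    ‖term τ ψ (point τ m n)‖ = (‖(m * τ + n : ℂ)‖ ^ 2)⁻¹ := by
  rw [norm_term, coe_point]

theorem summable_term_row (τ : ℍ) (ψ : LatticeChar τ) (m : ℤ) :
    Summable fun n : ℤ => term τ ψ (point τ m n) := by
  refine Summable.of_norm ?_
  have h := (EisensteinSeries.linear_right_summable (τ : ℂ) m (k := 2) le_rfl).norm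
  refine h.congr fun n => ?_
  rw [norm_term_point, norm_inv]
  norm_cast
  rw [norm_pow]

/-- The sum of `ψ(μ) / |μ|²` over the row `mτ + ℤ`. -/
noncomputable def row (τ : ℍ) (ψ : LatticeChar τ) (m : ℤ) : ℂ := ∑' n : ℤ, term τ ψ (point τ m n)

theorem hasSum_row (τ : ℍ) (ψ : LatticeChar τ) (m : ℤ) :
    HasSum (fun n : ℤ => term τ ψ (point τ m n)) (row τ ψ m) := (summable_term_row τ ψ m).hasSum

theorem point_sub_one (τ : ℍ) (m n : ℤ) : point τ m n - one τ = point τ m (n - 1) := by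
  rw [point_eq, point_eq]; module

theorem point_sub_gen (τ : ℍ) (m n : ℤ) : point τ m n - gen τ = point τ (m - 1) n := by
  rw [point_eq, point_eq]; module

theorem term_neg (τ : ℍ) (ψ : LatticeChar τ) (μ : lattice τ) :
    term τ ψ (-μ) = conj (term τ ψ μ) := by
  rw [term, term, AddChar.map_neg_eq_inv, Circle.coe_inv_eq_conj, map_div₀, Complex.conj_ofReal]
  congr 3
  rw [NegMemClass.coe_neg, norm_neg]

theorem row_neg (τ : ℍ) (ψ : LatticeChar τ) (m : ℤ) : row τ ψ (-m) = conj (row τ ψ m) := by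
  have h := (hasSum_row τ ψ m).map (starRingEnd ℂ) Complex.continuous_conj
  rw [← (Equiv.neg ℤ).hasSum_iff] at h
  refine (hasSum_row τ ψ (-m)).unique (h.congr_fun ?_)
  intro n
  simp only [Function.comp, Equiv.neg_apply]
  rw [← term_neg]
  congr 1
  rw [point_eq, point_eq]; module

/-- Translation by 1 preserves every row, so the absolutely convergent sum has row sums (1 -
ψ(1))·row, and the nonzero factor can be divided out. -/
theorem hasSum_row_of_one (τ : ℍ) {ψ : LatticeChar τ} (hψ : (ψ (one τ) : ℂ) ≠ 1) :
    HasSum (row τ ψ) (L τ ψ) := by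
  have hψ1 : ψ ≠ 1 := by rintro rfl; simp at hψ
  have h := (pointEquiv τ).hasSum_iff.mpr (hasSum_term_sub τ hψ1 (one τ))
  have h2 := h.prod_fiberwise (g := fun m => (1 - (ψ (one τ) : ℂ)) * row τ ψ m) fun m => by
    have h3 := ((Equiv.subRight (1 : ℤ)).hasSum_iff.mpr (hasSum_row τ ψ m)).mul_left
      (ψ (one τ) : ℂ)
    have h4 := (hasSum_row τ ψ m).sub h3
    rw [sub_mul, one_mul]
    refine h4.congr_fun fun n => ?_
    simp only [Function.comp, pointEquiv_apply, Equiv.subRight_apply, point_sub_one]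
  have h5 : (1 - (ψ (one τ) : ℂ)) ≠ 0 := sub_ne_zero.mpr (Ne.symm hψ)
  exact (hasSum_mul_left_iff h5).mp h2

/-- Translation by τ carries row m - 1 to row m, so only twisted differences of neighbouring rows
are obtained; this serves the case ψ(1) = 1. -/
theorem hasSum_row_sub_row (τ : ℍ) {ψ : LatticeChar τ} (hψ : ψ ≠ 1) :
    HasSum (fun m => row τ ψ m - (ψ (gen τ) : ℂ) * row τ ψ (m - 1))
      ((1 - (ψ (gen τ) : ℂ)) * L τ ψ) := by
  have h := (pointEquiv τ).hasSum_iff.mpr (hasSum_term_sub τ hψ (gen τ))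
  refine h.prod_fiberwise fun m => ?_
  refine ((hasSum_row τ ψ m).sub ((hasSum_row τ ψ (m - 1)).mul_left _)).congr_fun fun n => ?_
  simp only [Function.comp, pointEquiv_apply, point_sub_gen]

theorem tendsto_symmetric_sum_of_hasSum {f : ℤ → ℂ} {a : ℂ} (h : HasSum f a) :
    Tendsto (fun M : ℕ => f 0 + ∑ m ∈ Finset.range M, (f (m + 1) + f (-(m + 1)))) atTop (𝓝 a) := by
  -- Pairing n with -n over n ≥ 0 counts f 0 twice.
  have h1 := (h.nat_add_neg.tendsto_sum_nat.comp (tendsto_add_atTop_nat 1)).sub_const (f 0)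
  rw [add_sub_cancel_right] at h1
  refine h1.congr fun M => ?_
  simp only [Function.comp, Finset.sum_range_succ']
  push_cast
  rw [neg_zero]
  ring

theorem tendsto_sum_rows (τ : ℍ) {ψ : LatticeChar τ}
    (hψ : (ψ (one τ) : ℂ) ≠ 1 ∨ (ψ (gen τ) : ℂ) ≠ 1)
    (h0 : Tendsto (fun m : ℕ => row τ ψ m) atTop (𝓝 0)) :
    Tendsto (fun M : ℕ => row τ ψ 0 +
      ∑ m ∈ Finset.range M, ((2 * (row τ ψ (m + 1)).re : ℝ) : ℂ)) atTop (𝓝 (L τ ψ)) := by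
  have hre : ∀ m : ℤ, ((2 * (row τ ψ m).re : ℝ) : ℂ) = row τ ψ m + row τ ψ (-m) := fun m => by
    rw [row_neg, Complex.add_conj]
  simp only [hre]
  by_cases h1 : (ψ (one τ) : ℂ) = 1
  · have hg := hψ.resolve_left (not_not.mpr h1)
    have hψ1 : ψ ≠ 1 := by rintro rfl; simp at hg
    have h2 := tendsto_symmetric_sum_of_hasSum (hasSum_row_sub_row τ hψ1)
    set ρ := (ψ (gen τ) : ℂ)
    have hρ : 1 - ρ ≠ 0 := sub_ne_zero.mpr (Ne.symm hg)
    have h3 : Tendsto (fun M : ℕ => row τ ψ (-((M + 1 : ℕ) : ℤ))) atTop (𝓝 0) := by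
      have := (Complex.continuous_conj.tendsto 0).comp (h0.comp (tendsto_add_atTop_nat 1))
      rw [map_zero] at this
      exact this.congr fun M => by simp only [Function.comp]; rw [row_neg]
    -- With S the sum of the rows from -M to M, the differences telescope to (1 - ρ)S + ρ(row M -
    -- row (-M-1)), and the two end rows tend to 0.
    have h4 := (h2.sub ((h0.sub h3).const_mul ρ)).const_mul (1 - ρ)⁻¹
    rw [sub_zero, mul_zero, sub_zero, inv_mul_cancel_left₀ hρ] at h4
    refine h4.congr fun M => ?_
    rw [inv_mul_eq_iff_eq_mul₀ hρ]
    induction M with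
    | zero => simp; ring
    | succ M ih =>
      rw [Finset.sum_range_succ, Finset.sum_range_succ]
      have e1 : ((M : ℤ) + 1) - 1 = M := by ring
      have e2 : -((M : ℤ) + 1) - 1 = -((M + 1 + 1 : ℕ) : ℤ) := by push_cast; ring
      have e3 : -((M + 1 : ℕ) : ℤ) = -((M : ℤ) + 1) := by push_cast; ring
      have e4 : ((M + 1 : ℕ) : ℤ) = (M : ℤ) + 1 := by push_cast; ring
      rw [e1, e2, e4]
      rw [e3] at ih
      linear_combination ih
  · exact tendsto_symmetric_sum_of_hasSum (hasSum_row_of_one τ h1)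

/-! ### Exponentials and Fourier series for the rows -/

theorem e_add (z w : ℂ) : e (z + w) = e z * e w := by
  rw [e, e, e, ← Complex.exp_add, mul_add]

@[simp] theorem e_zero : e 0 = 1 := by simp [e]

theorem e_ne_zero (z : ℂ) : e z ≠ 0 := Complex.exp_ne_zero _

theorem e_neg (z : ℂ) : e (-z) = (e z)⁻¹ := by rw [e, e, mul_neg, Complex.exp_neg]

theorem e_sub (z w : ℂ) : e (z - w) = e z / e w := by
  rw [sub_eq_add_neg, e_add, e_neg, div_eq_mul_inv]

theorem e_natCast_mul (n : ℕ) (z : ℂ) : e (n * z) = e z ^ n := by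
  rw [e, e, ← Complex.exp_nat_mul]; ring_nf

theorem e_intCast_mul (n : ℤ) (z : ℂ) : e (n * z) = e z ^ n := by
  rw [e, e, ← Complex.exp_int_mul]; ring_nf

@[simp] theorem e_intCast (n : ℤ) : e n = 1 := by
  have h := e_intCast_mul n 1
  rw [mul_one] at h
  rw [h, e, mul_one, Complex.exp_two_pi_mul_I, one_zpow]

theorem norm_e (z : ℂ) : ‖e z‖ = Real.exp (-(2 * Real.pi * z.im)) := by
  rw [e, Complex.norm_exp]
  congr 1
  simp [Complex.mul_re, Complex.mul_im]

theorem conj_e (z : ℂ) : conj (e z) = e (-conj z) := by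
  rw [e, e, ← Complex.exp_conj]
  congr 1
  simp [Complex.conj_ofNat]

theorem norm_e_lt_one {z : ℂ} (hz : 0 < z.im) : ‖e z‖ < 1 := by
  rw [norm_e, Real.exp_lt_one_iff]
  have := Real.pi_pos
  have : 0 < 2 * Real.pi * z.im := by positivity
  linarith

theorem e_ofReal_eq_one_iff (x : ℝ) : e x = 1 ↔ ∃ k : ℤ, x = k := by
  rw [e, Complex.exp_eq_one_iff]
  refine exists_congr fun k => ?_
  rw [mul_comm (k : ℂ), mul_right_inj' Complex.two_pi_I_ne_zero]
  norm_cast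

theorem integral_e_mul {w : ℂ} (hw : w ≠ 0) :
    ∫ t in (0 : ℝ)..1, e (w * t) = (e w - 1) / (2 * Real.pi * Complex.I * w) := by
  simp only [e, ← mul_assoc]
  rw [integral_exp_mul_complex (mul_ne_zero Complex.two_pi_I_ne_zero hw)]
  simp

/-- The sum of the two geometric series arising from Poisson summation of `e(nt) / |n + c|²`. -/
noncomputable def poissonKernel (c : ℂ) (t : ℝ) : ℂ :=
  e ((1 - t) * c) / (1 - e c) + e (-(t * conj c)) / (1 - e (-conj c))

theorem one_sub_e_ne_zero {c : ℂ} (hc : 0 < c.im) : 1 - e c ≠ 0 := by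
  rw [sub_ne_zero]
  intro h
  have := norm_e_lt_one hc
  rw [← h] at this
  simp at this

theorem continuous_poissonKernel (c : ℂ) : Continuous (poissonKernel c) := by
  unfold poissonKernel e
  fun_prop

/-- Equal end values make the kernel a continuous function on the circle. -/
theorem poissonKernel_zero_eq_one {c : ℂ} (hc : 0 < c.im) :
    poissonKernel c 0 = poissonKernel c 1 := by
  have h1 := one_sub_e_ne_zero hc
  have h2 := one_sub_e_ne_zero (c := -conj c) (by simpa using hc)
  simp only [poissonKernel, Complex.ofReal_zero, Complex.ofReal_one, sub_zero, one_mul, sub_self,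
    zero_mul, neg_zero, e_zero]
  field_simp
  ring

/-- The denominators of the kernel cancel the boundary values of the integrals, leaving (1/(n + c̄)
- 1/(n + c))/(2πi), and c - c̄ = 2i·Im c. -/
theorem fourierCoeffOn_poissonKernel {c : ℂ} (hc : 0 < c.im) (n : ℤ) :
    fourierCoeffOn zero_lt_one (poissonKernel c) n =
      ((c.im / Real.pi * (‖(n : ℂ) + c‖ ^ 2)⁻¹ : ℝ) : ℂ) := by
  have h1 := one_sub_e_ne_zero hc
  have h2 := one_sub_e_ne_zero (c := -conj c) (by simpa using hc)
  have hne : (n : ℂ) + c ≠ 0 := fun h => by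
    have := congrArg Complex.im h
    simp at this
    exact hc.ne' this
  have hne' : (n : ℂ) + conj c ≠ 0 := fun h => hne (by simpa using congrArg conj h)
  have e1 : ∀ t : ℝ, fourier (-n) (t : AddCircle (1 - 0 : ℝ)) • poissonKernel c t =
      e c / (1 - e c) * e (-(n + c) * t) + (1 - e (-conj c))⁻¹ * e (-(n + conj c) * t) := by
    intro t
    have hf : fourier (-n) (t : AddCircle (1 - 0 : ℝ)) = e (-n * t) := by
      rw [fourier_coe_apply, e]; push_cast; ring_nf
    have e2 : (1 - (t : ℂ)) * c = c + -(t * c) := by ring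
    have e3 : (-(n + c) * t : ℂ) = -n * t + -(t * c) := by ring
    have e4 : (-(n + conj c) * t : ℂ) = -n * t + -(t * conj c) := by ring
    rw [hf, poissonKernel, e2, e3, e4, e_add, e_add, e_add, smul_eq_mul]
    ring
  have hcont : ∀ w : ℂ, Continuous fun t : ℝ => e (w * t) := fun w => by unfold e; fun_prop
  rw [fourierCoeffOn_eq_integral, intervalIntegral.integral_congr fun t _ => e1 t,
    intervalIntegral.integral_add, intervalIntegral.integral_const_mul,
    intervalIntegral.integral_const_mul, integral_e_mul (neg_ne_zero.mpr hne),
    integral_e_mul (neg_ne_zero.mpr hne')]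
  · have e5 : e (-((n : ℂ) + c)) = (e c)⁻¹ := by rw [e_neg, e_add, e_intCast, one_mul]
    have e6 : e (-((n : ℂ) + conj c)) = e (-conj c) := by
      rw [neg_add, e_add, ← Int.cast_neg, e_intCast, one_mul]
    have hec := e_ne_zero c
    have hnorm : ((‖(n : ℂ) + c‖ ^ 2 : ℝ) : ℂ) = (n + c) * (n + conj c) := by
      have := Complex.mul_conj' ((n : ℂ) + c)
      rw [map_add, map_intCast] at this
      rw [this]; push_cast; rfl
    have him : (c.im : ℂ) = (c - conj c) / (2 * Complex.I) := by
      rw [Complex.sub_conj]; field_simp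
      push_cast; ring
    have hπ : (Real.pi : ℂ) ≠ 0 := by exact_mod_cast Real.pi_ne_zero
    rw [e5, e6]
    push_cast at hnorm ⊢
    rw [hnorm, him]
    have hI := Complex.I_ne_zero
    simp only [sub_zero, div_one, one_smul]
    field_simp
    ring
  · exact ((hcont _).const_mul _).intervalIntegrable _ _
  · exact ((hcont _).const_mul _).intervalIntegrable _ _

theorem summable_inv_norm_int_add_sq {c : ℂ} :
    Summable fun n : ℤ => (‖(n : ℂ) + c‖ ^ 2)⁻¹ := by
  have h := (EisensteinSeries.linear_right_summable c 1 (k := 2) le_rfl).norm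
  refine h.congr fun n => ?_
  rw [norm_inv, Int.cast_one, one_mul, add_comm]
  norm_cast
  rw [norm_pow]

/-- The Fourier coefficients of the continuous kernel are absolutely summable, so its Fourier series
converges to it at every point. -/
theorem hasSum_e_div_norm_add_sq {c : ℂ} (hc : 0 < c.im) {v : ℝ} (hv : v ∈ Set.Ico (0 : ℝ) 1) :
    HasSum (fun n : ℤ => e v ^ n / ((‖(n : ℂ) + c‖ ^ 2 : ℝ) : ℂ))
      (Real.pi / c.im * poissonKernel c v) := by
  have hπ := Real.pi_pos
  let f : C(AddCircle (1 : ℝ), ℂ) := ⟨AddCircle.liftIco 1 0 (poissonKernel c),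
    AddCircle.liftIco_zero_continuous (poissonKernel_zero_eq_one hc)
      (continuous_poissonKernel c).continuousOn⟩
  have hcoeff : ∀ n : ℤ, fourierCoeff f n =
      ((c.im / Real.pi * (‖(n : ℂ) + c‖ ^ 2)⁻¹ : ℝ) : ℂ) := fun n => by
    rw [ContinuousMap.coe_mk, fourierCoeff_liftIco_eq]
    simpa only [zero_add] using! fourierCoeffOn_poissonKernel hc n
  have hsum : Summable (fourierCoeff f) := by
    refine Summable.congr ?_ fun n => (hcoeff n).symm
    exact Complex.ofRealCLM.summable (summable_inv_norm_int_add_sq.mul_left _)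
  have h := (has_pointwise_sum_fourier_series_of_summable hsum (v : AddCircle (1 : ℝ))).mul_left
    ((Real.pi / c.im : ℝ) : ℂ)
  have hfv : f (v : AddCircle (1 : ℝ)) = poissonKernel c v := by
    rw [ContinuousMap.coe_mk, AddCircle.liftIco_coe_apply (by simpa using hv)]
  rw [hfv] at h
  convert! h using 1
  · ext n
    rw [hcoeff, fourier_coe_apply, ← e_intCast_mul, e, smul_eq_mul]
    have e1 : (2 * Real.pi * Complex.I * n * v / (1 : ℝ) : ℂ) =
      2 * Real.pi * Complex.I * (n * v) := by push_cast; ring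
    have hc' : (c.im : ℂ) ≠ 0 := by exact_mod_cast hc.ne'
    have hπ' : (Real.pi : ℂ) ≠ 0 := by exact_mod_cast hπ.ne'
    rw [e1]
    push_cast
    field_simp
  · push_cast; rfl

/-- This is the Fourier series of the second Bernoulli polynomial; the term n = 0 vanishes because
division by zero gives 0. -/
theorem hasSum_e_div_norm_sq {v : ℝ} (hv : v ∈ Set.Icc (0 : ℝ) 1) :
    HasSum (fun n : ℤ => e v ^ n / ((‖(n : ℂ)‖ ^ 2 : ℝ) : ℂ)) ((2 * Real.pi ^ 2 * B₂ v : ℝ) : ℂ) := by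
  have h := hasSum_one_div_pow_mul_fourier_mul_bernoulliFun (le_refl 2) hv
  convert! h using 1
  · ext n
    rw [fourier_coe_apply, ← e_intCast_mul, e]
    have e1 : (2 * Real.pi * Complex.I * n * v / (1 : ℝ) : ℂ) =
      2 * Real.pi * Complex.I * (n * v) := by push_cast; ring
    have e2 : ((‖(n : ℂ)‖ ^ 2 : ℝ) : ℂ) = (n : ℂ) ^ 2 := by
      rw [Complex.norm_intCast, sq_abs]; push_cast; rfl
    rw [e1, e2]
    ring
  · rw [bernoulliFun_two, B₂]
    push_cast [mul_pow, Complex.I_sq, Nat.factorial_two]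
    ring

/-! ### Logarithmic series -/

theorem hasSum_re_pow_div {w : ℂ} (hw : ‖w‖ < 1) :
    HasSum (fun k : ℕ => (w ^ (k + 1)).re / (k + 1)) (-Real.log ‖1 - w‖) := by
  have h := (hasSum_nat_add_iff' 1).mpr (Complex.hasSum_taylorSeries_neg_log hw)
  have h2 := Complex.hasSum_re h
  convert! h2 using 1
  · ext k
    rw [← Complex.div_ofReal_re]
    push_cast
    rfl
  · simp [Complex.log_re]

/-- Needed for |w| = 1, where absolute convergence fails. Convergence is a hypothesis; Abel's limit
theorem identifies the limit from the values at xw with x < 1. -/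
theorem tendsto_log_norm_of_tendsto_sum {w : ℂ} (hw : ‖w‖ ≤ 1) (hw1 : w ≠ 1) {l : ℝ}
    (h : Tendsto (fun M : ℕ => ∑ m ∈ Finset.range M, (w ^ (m + 1)).re / (m + 1)) atTop (𝓝 l)) :
    l = -Real.log ‖1 - w‖ := by
  have h0 : Tendsto (fun M : ℕ => ∑ n ∈ Finset.range M, (w ^ n).re / n) atTop (𝓝 l) := by
    rw [← tendsto_add_atTop_iff_nat 1]
    refine h.congr fun M => ?_
    rw [Finset.sum_range_succ']
    simp
  have h1 := Real.tendsto_tsum_powerSeries_nhdsWithin_lt h0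
  have h2 : Tendsto (fun x : ℝ => -Real.log ‖1 - x * w‖) (𝓝[<] 1) (𝓝 (-Real.log ‖1 - w‖)) := by
    have hne : ‖1 - ((1 : ℝ) : ℂ) * w‖ ≠ 0 := by
      simpa [sub_eq_zero] using hw1.symm
    have hc : ContinuousAt (fun x : ℝ => -Real.log ‖1 - x * w‖) 1 :=
      (ContinuousAt.log (f := fun x : ℝ => ‖1 - x * w‖) (by fun_prop) hne).neg
    have := hc.tendsto.mono_left (nhdsWithin_le_nhds (s := Set.Iio 1))
    simpa using this
  refine tendsto_nhds_unique h1 (h2.congr' ?_)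
  filter_upwards [Ioo_mem_nhdsLT (zero_lt_one' ℝ)] with x hx
  have hxw : ‖x * w‖ < 1 := by
    rw [norm_mul, Complex.norm_real, Real.norm_of_nonneg hx.1.le]
    exact (mul_le_of_le_one_right hx.1.le hw).trans_lt hx.2
  have h3 := hasSum_re_pow_div hxw
  have h4 : HasSum (fun n : ℕ => (w ^ n).re / n * x ^ n) (-Real.log ‖1 - x * w‖) := by
    rw [← hasSum_nat_add_iff' 1]
    convert! h3 using 1
    · ext k
      rw [mul_pow, ← Complex.ofReal_pow, Complex.re_ofReal_mul]
      push_cast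
      ring
    · simp
  exact h4.tsum_eq.symm

/-- The logarithm of an infinite product of factors `1 - wⱼ` with `wⱼ` geometrically small, as a
sum over powers. -/
theorem hasSum_tsum_re_pow_div {w : ℕ → ℂ} {ρ r : ℝ} (hρ0 : 0 ≤ ρ) (hρ : ρ < 1) (hr0 : 0 ≤ r)
    (hr : r < 1) (hw : ∀ j, ‖w j‖ ≤ ρ * r ^ j) :
    Summable (fun j => Real.log ‖1 - w j‖) ∧
    HasSum (fun k : ℕ => ∑' j, (w j ^ (k + 1)).re / (k + 1)) (-∑' j, Real.log ‖1 - w j‖) := by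
  have hw1 : ∀ j, ‖w j‖ < 1 := fun j =>
    ((hw j).trans (mul_le_of_le_one_right hρ0 (pow_le_one₀ hr0 hr.le))).trans_lt hρ
  have hgeom : Summable fun k : ℕ => ρ ^ (k + 1) :=
    (summable_nat_add_iff 1).mpr (summable_geometric_of_lt_one hρ0 hρ)
  -- Because (ρrʲ)^(k+1) ≤ rʲρ^(k+1), this majorant makes the double series absolutely summable, and
  -- the order of summation can be exchanged.
  have hmaj : Summable fun p : ℕ × ℕ => r ^ p.1 * ρ ^ (p.2 + 1) :=
    Summable.mul_of_nonneg (f := fun j : ℕ => r ^ j) (g := fun k : ℕ => ρ ^ (k + 1))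
      (summable_geometric_of_lt_one hr0 hr) hgeom
      (fun j => pow_nonneg hr0 j) (fun k => pow_nonneg hρ0 (k + 1))
  obtain ⟨F, hF⟩ : ∃ F : ℕ → ℕ → ℝ, ∀ j k, F j k = (w j ^ (k + 1)).re / ((k : ℝ) + 1) :=
    ⟨_, fun _ _ => rfl⟩
  have hs : Summable fun p : ℕ × ℕ => F p.1 p.2 := by
    refine Summable.of_norm_bounded hmaj fun p => ?_
    rw [hF]
    rw [norm_div, Real.norm_eq_abs, Real.norm_of_nonneg (by positivity)]
    have h1 : |(w p.1 ^ (p.2 + 1)).re| ≤ r ^ p.1 * ρ ^ (p.2 + 1) := by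
      calc _ ≤ ‖w p.1 ^ (p.2 + 1)‖ := Complex.abs_re_le_norm _
        _ ≤ (ρ * r ^ p.1) ^ (p.2 + 1) := by rw [norm_pow]; gcongr; exact hw _
        _ = (r ^ p.1) ^ (p.2 + 1) * ρ ^ (p.2 + 1) := by rw [mul_pow, mul_comm]
        _ ≤ _ := by
          gcongr
          exact pow_le_of_le_one (by positivity) (pow_le_one₀ hr0 hr.le) (by omega)
    have h2 : (1 : ℝ) ≤ (p.2 : ℝ) + 1 := le_add_of_nonneg_left (Nat.cast_nonneg p.2)
    exact (div_le_self (abs_nonneg _) h2).trans h1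
  have hrow : ∀ j, HasSum (F j) (-Real.log ‖1 - w j‖) := fun j =>
    (hasSum_re_pow_div (hw1 j)).congr_fun fun k => hF j k
  have hlog : HasSum (fun j => -Real.log ‖1 - w j‖) (∑' p : ℕ × ℕ, F p.1 p.2) :=
    hs.hasSum.prod_fiberwise hrow
  have hlog' : HasSum (fun j => Real.log ‖1 - w j‖) (-∑' p : ℕ × ℕ, F p.1 p.2) := by
    simpa only [neg_neg] using hlog.neg
  refine ⟨hlog'.summable, ?_⟩
  rw [hlog'.tsum_eq, neg_neg]
  simp only [← hF]
  have h2 : HasSum (fun p : ℕ × ℕ => F p.2 p.1) (∑' p : ℕ × ℕ, F p.1 p.2) :=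
    (Equiv.prodComm ℕ ℕ).hasSum_iff.mpr hs.hasSum
  exact h2.prod_fiberwise fun k => (h2.summable.prod_factor k).hasSum

theorem tsum_re_geometric_div {a q : ℂ} (hq : ‖q‖ < 1) (k : ℕ) :
    ∑' j : ℕ, ((a * q ^ j) ^ (k + 1)).re / ((k : ℝ) + 1) =
      (a ^ (k + 1) / (1 - q ^ (k + 1))).re / (k + 1) := by
  have hq' : ‖q ^ (k + 1)‖ < 1 := by
    rw [norm_pow]; exact pow_lt_one₀ (norm_nonneg _) hq (by omega)
  have h := (hasSum_geometric_of_norm_lt_one hq').mul_left (a ^ (k + 1))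
  have h2 := (Complex.hasSum_re h).div_const ((k : ℝ) + 1)
  rw [← div_eq_mul_inv] at h2
  rw [← h2.tsum_eq]
  refine tsum_congr fun j => ?_
  rw [mul_pow, ← pow_mul, ← pow_mul, mul_comm j]

/-! ### Closed forms of the rows and of L -/

section Rows

variable {τ : ℍ} {ψ : LatticeChar τ} {u v : ℝ}

theorem row_zero (hv : v ∈ Set.Ico (0 : ℝ) 1) (h1 : (ψ (one τ) : ℂ) = e v) :
    row τ ψ 0 = ((2 * Real.pi ^ 2 * B₂ v : ℝ) : ℂ) := by
  refine (hasSum_row τ ψ 0).unique ((hasSum_e_div_norm_sq ⟨hv.1, hv.2.le⟩).congr_fun fun n => ?_)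
  rw [term, char_point, h1, coe_point, zpow_zero, one_mul, Int.cast_zero, zero_mul, zero_add]

theorem row_eq (hv : v ∈ Set.Ico (0 : ℝ) 1) (h1 : (ψ (one τ) : ℂ) = e v)
    (hg : (ψ (gen τ) : ℂ) = e u) {m : ℕ} (hm : 0 < m) :
    row τ ψ m = e u ^ m * (Real.pi / (m * τ.im : ℝ) * poissonKernel (m * τ) v) := by
  have him : ((m : ℂ) * τ).im = m * τ.im := by simp
  have hpos : 0 < ((m : ℂ) * τ).im := by
    rw [him]; exact mul_pos (by exact_mod_cast hm) τ.im_pos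
  have h := (hasSum_e_div_norm_add_sq hpos hv).mul_left (e u ^ m)
  rw [him] at h
  refine (hasSum_row τ ψ m).unique (h.congr_fun fun n => ?_)
  rw [term, char_point, h1, hg, coe_point, zpow_natCast, Int.cast_natCast, add_comm (n : ℂ)]
  ring

theorem norm_e_ofReal (x : ℝ) : ‖e x‖ = 1 := by simp [norm_e]

/-- The decay comes from the factor π/(m Im τ). The kernel is bounded uniformly in m: for 0 ≤ v < 1
its numerators have norm at most 1, and its denominators at least 1 - |q|. -/
theorem tendsto_row (hv : v ∈ Set.Ico (0 : ℝ) 1) (h1 : (ψ (one τ) : ℂ) = e v)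
    (hg : (ψ (gen τ) : ℂ) = e u) : Tendsto (fun m : ℕ => row τ ψ m) atTop (𝓝 0) := by
  have hy := τ.im_pos
  have hq : ‖e (τ : ℂ)‖ < 1 := norm_e_lt_one τ.im_pos
  have hπ := Real.pi_pos
  have hlim : Tendsto (fun m : ℕ => Real.pi / τ.im * (2 * (1 - ‖e (τ : ℂ)‖)⁻¹) * (m : ℝ)⁻¹)
      atTop (𝓝 0) := by
    simpa using (tendsto_inv_atTop_nhds_zero_nat (𝕜 := ℝ)).const_mul
      (Real.pi / τ.im * (2 * (1 - ‖e (τ : ℂ)‖)⁻¹))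
  refine squeeze_zero_norm' ?_ hlim
  filter_upwards [eventually_gt_atTop 0] with m hm
  have hm' : (0 : ℝ) < m := by exact_mod_cast hm
  have hden : ∀ c : ℂ, ‖c‖ = ‖e (τ : ℂ)‖ ^ m → 1 - ‖e (τ : ℂ)‖ ≤ ‖1 - c‖ := fun c hc => by
    have h2 : ‖c‖ ≤ ‖e (τ : ℂ)‖ := by
      rw [hc]; exact pow_le_of_le_one (norm_nonneg _) hq.le hm.ne'
    have h3 := norm_sub_norm_le (1 : ℂ) c
    rw [norm_one] at h3
    linarith
  have hle : ∀ z : ℂ, 0 ≤ z.im → ‖e z‖ ≤ 1 := fun z hz => by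
    rw [norm_e, Real.exp_le_one_iff]
    have : 0 ≤ 2 * Real.pi * z.im := by positivity
    linarith
  have hP : ‖poissonKernel (m * τ) v‖ ≤ 2 * (1 - ‖e (τ : ℂ)‖)⁻¹ := by
    have hpos : 0 < 1 - ‖e (τ : ℂ)‖ := by linarith
    have hA : ‖e ((1 - v) * (m * τ)) / (1 - e (m * τ))‖ ≤ (1 - ‖e (τ : ℂ)‖)⁻¹ := by
      rw [norm_div, div_eq_mul_inv]
      have := hle ((1 - v) * (m * τ)) (by
        have e1 : ((1 - (v : ℂ)) * (m * τ)).im = (1 - v) * (m * τ.im) := by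
          simp [Complex.mul_im]
        rw [e1]
        have := hv.2
        have : 0 ≤ 1 - v := by linarith
        positivity)
      have h2 := hden (e (m * τ)) (by rw [e_natCast_mul, norm_pow])
      calc _ ≤ 1 * (1 - ‖e (τ : ℂ)‖)⁻¹ := by gcongr
        _ = _ := one_mul _
    have hB : ‖e (-(v * conj ((m : ℂ) * τ))) / (1 - e (-conj ((m : ℂ) * τ)))‖ ≤
        (1 - ‖e (τ : ℂ)‖)⁻¹ := by
      rw [norm_div, div_eq_mul_inv]
      have := hle (-(v * conj ((m : ℂ) * τ))) (by
        have e1 : (-((v : ℂ) * conj ((m : ℂ) * τ))).im = v * (m * τ.im) := by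
          simp [Complex.mul_im]
        rw [e1]
        have := hv.1
        positivity)
      have h2 := hden (e (-conj ((m : ℂ) * τ))) (by
        rw [← conj_e, RCLike.norm_conj, e_natCast_mul, norm_pow])
      calc _ ≤ 1 * (1 - ‖e (τ : ℂ)‖)⁻¹ := by gcongr
        _ = _ := one_mul _
    calc _ ≤ _ := norm_add_le _ _
      _ ≤ _ := add_le_add hA hB
      _ = _ := by ring
  rw [row_eq hv h1 hg hm, norm_mul, norm_pow, norm_e_ofReal, one_pow, one_mul, norm_mul, norm_div,
    Complex.norm_real, Complex.norm_real, Real.norm_of_nonneg hπ.le,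
    Real.norm_of_nonneg (by positivity)]
  calc _ ≤ Real.pi / (m * τ.im) * (2 * (1 - ‖e (τ : ℂ)‖)⁻¹) := by gcongr
    _ = _ := by field_simp

theorem two_mul_re_row (hv : v ∈ Set.Ico (0 : ℝ) 1) (h1 : (ψ (one τ) : ℂ) = e v)
    (hg : (ψ (gen τ) : ℂ) = e u) (m : ℕ) :
    2 * (row τ ψ (m + 1)).re = 2 * Real.pi / τ.im *
      ((e (u + (1 - v) * τ) ^ (m + 1) / (1 - e τ ^ (m + 1))).re / (m + 1) +
       (e (-u + v * τ) ^ (m + 1) / (1 - e τ ^ (m + 1))).re / (m + 1)) := by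
  have hrow := row_eq hv h1 hg (Nat.succ_pos m)
  rw [Nat.cast_succ] at hrow
  have e1 : (Real.pi / (((m + 1 : ℕ) : ℝ) * τ.im : ℝ) : ℂ) =
      ((Real.pi / ((m + 1) * τ.im) : ℝ) : ℂ) := by push_cast; rfl
  -- The second summand of the kernel is the conjugate of a β-term, and conjugation is invisible to
  -- the real part.
  have e2 : e u ^ (m + 1) * poissonKernel ((m + 1 : ℕ) * τ) v =
      e (u + (1 - v) * τ) ^ (m + 1) / (1 - e τ ^ (m + 1)) +
      conj (e (-u + v * τ) ^ (m + 1) / (1 - e τ ^ (m + 1))) := by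
    rw [poissonKernel, ← e_natCast_mul, ← e_natCast_mul, ← e_natCast_mul, ← e_natCast_mul, mul_add,
      ← mul_div_assoc, ← mul_div_assoc, ← e_add, ← e_add, map_div₀, map_sub, map_one, conj_e,
      conj_e]
    congr 3
    · ring
    · simp only [map_mul, map_add, map_neg, Complex.conj_ofReal, map_natCast]
      ring
  rw [hrow, e1, mul_left_comm, e2, Complex.re_ofReal_mul, Complex.add_re, Complex.conj_re]
  have := τ.im_pos.ne'
  have : (m : ℝ) + 1 ≠ 0 := by positivity
  field_simp

/-- The Kronecker limit in terms of the logarithms of the factors of the Siegel function. -/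
theorem L_eq_log (hv : v ∈ Set.Ico (0 : ℝ) 1) (huv : ¬((∃ k : ℤ, u = k) ∧ v = 0))
    (h1 : (ψ (one τ) : ℂ) = e v) (hg : (ψ (gen τ) : ℂ) = e u) :
    e (-u + v * τ) ≠ 1 ∧
    Summable (fun j : ℕ => Real.log ‖1 - e (u + (1 - v) * τ) * e τ ^ j‖) ∧
    Summable (fun j : ℕ => Real.log ‖1 - e (-u + v * τ) * e τ ^ (j + 1)‖) ∧
    L τ ψ = ((2 * Real.pi ^ 2 * B₂ v - 2 * Real.pi / τ.im *
      (∑' j : ℕ, Real.log ‖1 - e (u + (1 - v) * τ) * e τ ^ j‖ +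
       ∑' j : ℕ, Real.log ‖1 - e (-u + v * τ) * e τ ^ (j + 1)‖ +
       Real.log ‖1 - e (-u + v * τ)‖) : ℝ) : ℂ) := by
  have hy := τ.im_pos
  have hπ := Real.pi_pos
  set q := e (τ : ℂ) with hqdef
  have hq : ‖q‖ < 1 := norm_e_lt_one τ.im_pos
  set α := e (u + (1 - v) * τ) with hα
  set β := e (-u + v * τ) with hβ
  have hαn : ‖α‖ < 1 := by
    refine norm_e_lt_one ?_
    have e1 : ((u : ℂ) + (1 - v) * τ).im = (1 - v) * τ.im := by simp [Complex.mul_im]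
    rw [e1]
    have := hv.2
    exact mul_pos (by linarith) hy
  have hβim : (-(u : ℂ) + v * τ).im = v * τ.im := by simp [Complex.mul_im]
  have hβn : ‖β‖ ≤ 1 := by
    rw [hβ, norm_e, hβim, Real.exp_le_one_iff]
    have := hv.1
    have : 0 ≤ 2 * Real.pi * (v * τ.im) := by positivity
    linarith
  -- |β| = 1 forces v = 0, and then β = e(-u) = 1 would make u an integer.
  have hβ1 : β ≠ 1 := by
    intro h
    have hn : ‖β‖ = 1 := by rw [h, norm_one]
    rw [hβ, norm_e, hβim, Real.exp_eq_one_iff, neg_eq_zero] at hn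
    have hv0 : v = 0 := by
      have h2π : 2 * Real.pi ≠ 0 := by positivity
      exact (mul_eq_zero.mp ((mul_eq_zero.mp hn).resolve_left h2π)).resolve_right hy.ne'
    rw [hβ, hv0, Complex.ofReal_zero, zero_mul, add_zero, ← Complex.ofReal_neg,
      e_ofReal_eq_one_iff] at h
    obtain ⟨k, hk⟩ := h
    exact huv ⟨⟨-k, by push_cast; linarith⟩, hv0⟩
  obtain ⟨hsα, hlα⟩ := hasSum_tsum_re_pow_div (w := fun j => α * q ^ j) (norm_nonneg α) hαn
    (norm_nonneg q) hq fun j => by rw [norm_mul, norm_pow]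
  have hβq : ‖β * q‖ < 1 := by
    rw [norm_mul]; exact (mul_le_of_le_one_left (norm_nonneg _) hβn).trans_lt hq
  obtain ⟨hsβ, hlβ⟩ := hasSum_tsum_re_pow_div (w := fun j => β * q * q ^ j) (norm_nonneg (β * q))
    hβq (norm_nonneg q) hq fun j => by rw [norm_mul, norm_pow]
  have hβpow : ∀ j : ℕ, β * q * q ^ j = β * q ^ (j + 1) := fun j => by ring
  simp only [tsum_re_geometric_div hq] at hlα hlβ
  simp only [hβpow] at hsβ hlβ
  refine ⟨hβ1, hsα, hsβ, ?_⟩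
  set A := ∑' j : ℕ, Real.log ‖1 - α * q ^ j‖
  set B := ∑' j : ℕ, Real.log ‖1 - β * q ^ (j + 1)‖
  have hcond : (ψ (one τ) : ℂ) ≠ 1 ∨ (ψ (gen τ) : ℂ) ≠ 1 := by
    by_contra! H
    rw [h1, hg, e_ofReal_eq_one_iff, e_ofReal_eq_one_iff] at H
    obtain ⟨⟨k, hk⟩, hu⟩ := H
    refine huv ⟨hu, ?_⟩
    have h0 : Int.fract v = v := Int.fract_eq_self.mpr hv
    rw [← h0, hk, Int.fract_intCast]
  have hlim := tendsto_sum_rows τ hcond (tendsto_row hv h1 hg)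
  rw [row_zero hv h1] at hlim
  simp only [two_mul_re_row hv h1 hg] at hlim
  have hre := (Complex.continuous_re.tendsto _).comp hlim
  have him := (Complex.continuous_im.tendsto _).comp hlim
  simp only [Function.comp_def, ← Complex.ofReal_sum, ← Complex.ofReal_add, Complex.ofReal_re,
    Complex.ofReal_im] at hre him
  have hLim : (L τ ψ).im = 0 := (tendsto_nhds_unique him tendsto_const_nhds)
  -- Splitting β^(m+1)/(1 - q^(m+1)) isolates the one factor 1 - β that may have |β| = 1. Its
  -- logarithmic series converges because the row sums and the other two series do.
  have hrest : Tendsto (fun M : ℕ => ∑ m ∈ Finset.range M, (β ^ (m + 1)).re / ((m : ℝ) + 1)) atTop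
      (𝓝 (((L τ ψ).re - 2 * Real.pi ^ 2 * B₂ v) * (τ.im / (2 * Real.pi)) + A + B)) := by
    have h2 := (((hre.sub_const (2 * Real.pi ^ 2 * B₂ v)).mul_const (τ.im / (2 * Real.pi))).sub
      hlα.tendsto_sum_nat).sub hlβ.tendsto_sum_nat
    rw [sub_neg_eq_add, sub_neg_eq_add] at h2
    refine h2.congr fun M => ?_
    rw [add_sub_cancel_left, ← Finset.mul_sum, mul_right_comm]
    have e1 : 2 * Real.pi / τ.im * (τ.im / (2 * Real.pi)) = 1 := by field_simp
    rw [e1, one_mul, ← Finset.sum_sub_distrib, ← Finset.sum_sub_distrib]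
    refine Finset.sum_congr rfl fun m _ => ?_
    have hqm : 1 - q ^ (m + 1) ≠ 0 := by
      rw [hqdef, ← e_natCast_mul]
      refine one_sub_e_ne_zero ?_
      have e2 : (((m + 1 : ℕ) : ℂ) * τ).im = (m + 1 : ℕ) * τ.im := by simp
      rw [e2]; positivity
    have e3 : β ^ (m + 1) / (1 - q ^ (m + 1)) =
        (β * q) ^ (m + 1) / (1 - q ^ (m + 1)) + β ^ (m + 1) := by
      rw [mul_pow]; field_simp; ring
    rw [e3, Complex.add_re]
    ring
  have hfin := tendsto_log_norm_of_tendsto_sum hβn hβ1 hrest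
  refine Complex.ext ?_ (by rw [hLim, Complex.ofReal_im])
  rw [Complex.ofReal_re]
  field_simp at hfin ⊢
  linarith

end Rows

/-! ### The theta product and the Siegel function -/

theorem multipliable_one_sub_pow_mul {q : ℂ} (hq : ‖q‖ < 1) (c : ℂ) :
    Multipliable fun n : ℕ => 1 - q ^ n * c := by
  simpa [sub_eq_add_neg] using Complex.multipliable_one_add_of_summable
    ((summable_geometric_of_norm_lt_one hq).mul_right c).neg

theorem tprod_one_sub_pow_mul {q : ℂ} (hq : ‖q‖ < 1) (c : ℂ) :
    ∏' n : ℕ, (1 - q ^ n * c) = (1 - c) * ∏' n : ℕ, (1 - q ^ n * (q * c)) := by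
  have e : ∀ n : ℕ, 1 - q ^ (n + 1) * c = 1 - q ^ n * (q * c) := fun n => by ring
  rw [tprod_eq_zero_mul', pow_zero, one_mul]
  · simp only [e]
  · simpa only [e] using multipliable_one_sub_pow_mul hq (q * c)

/-- The theta product `(1 - w) ∏ (1 - qⁿ w)(1 - qⁿ / w)`. -/
noncomputable def theta (q w : ℂ) : ℂ :=
  (1 - w) * ∏' n : ℕ, ((1 - q ^ (n + 1) * w) * (1 - q ^ (n + 1) / w))

theorem theta_eq_mul {q : ℂ} (hq : ‖q‖ < 1) (w : ℂ) :
    theta q w = (∏' n : ℕ, (1 - q ^ n * w)) * ∏' n : ℕ, (1 - q ^ n * (q * w⁻¹)) := by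
  have e : ∀ n : ℕ, (1 - q ^ (n + 1) * w) * (1 - q ^ (n + 1) / w) =
      (1 - q ^ n * (q * w)) * (1 - q ^ n * (q * w⁻¹)) := fun n => by ring
  rw [theta, tprod_one_sub_pow_mul hq w]
  simp only [e]
  rw [(multipliable_one_sub_pow_mul hq _).tprod_mul (multipliable_one_sub_pow_mul hq _), mul_assoc]

/-- Replacing w by qw removes the factor 1 - w from one product and adds 1 - w⁻¹ = -w⁻¹(1 - w) to
the other. -/
theorem theta_mul {q : ℂ} (hq : ‖q‖ < 1) (hq0 : q ≠ 0) {w : ℂ} (hw : w ≠ 0) :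
    theta q (q * w) = -w⁻¹ * theta q w := by
  have e : q * (q * w)⁻¹ = w⁻¹ := by field_simp
  rw [theta_eq_mul hq, theta_eq_mul hq, tprod_one_sub_pow_mul hq w, e,
    tprod_one_sub_pow_mul hq w⁻¹]
  field_simp
  ring_nf

theorem norm_siegel (a₁ a₂ : ℝ) (τ : ℍ) :
    ‖siegel a₁ a₂ τ‖ =
      Real.exp (-(Real.pi * B₂ a₁ * τ.im)) * ‖theta (e τ) (e (a₁ * τ + a₂))‖ := by
  have h : siegel a₁ a₂ τ = -e ((B₂ a₁ / 2 : ℝ) * τ) * e ((a₂ * (a₁ - 1) / 2 : ℝ)) *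
      theta (e τ) (e (a₁ * τ + a₂)) := by
    rw [siegel, theta, mul_assoc]
  rw [h, norm_mul, norm_mul, norm_neg, norm_e_ofReal, mul_one, norm_e]
  congr 2
  rw [Complex.im_ofReal_mul]
  change -(2 * Real.pi * (B₂ a₁ / 2 * τ.im)) = _
  ring

/-- B₂(a + 1) - B₂(a) = 2a, and the resulting exponential cancels the factor |w|⁻¹ from `theta_mul`.
-/
theorem norm_siegel_periodic (a₂ : ℝ) (τ : ℍ) :
    Function.Periodic (fun a₁ => ‖siegel a₁ a₂ τ‖) 1 := by
  intro a
  have e1 : e (((a + 1 : ℝ) : ℂ) * τ + a₂) = e τ * e (a * τ + a₂) := by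
    rw [← e_add]; congr 1; push_cast; ring
  have him : ((a : ℂ) * τ + a₂).im = a * τ.im := by simp
  simp only
  rw [norm_siegel, norm_siegel, e1, theta_mul (norm_e_lt_one τ.im_pos) (e_ne_zero _) (e_ne_zero _),
    norm_mul, norm_neg, norm_inv, norm_e ((a : ℂ) * τ + a₂), him, ← Real.exp_neg, ← mul_assoc,
    ← Real.exp_add]
  congr 2
  simp only [B₂]
  ring

/-- With w = e(-vτ + u), β is w⁻¹ and the product already has the factors of `L_eq_log`. The leading
factor is 1 - w = -w(1 - β), and |w| = exp(2πv Im τ) turns B₂(-v) into B₂(-v) - 2v = B₂(v). -/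
theorem siegel_neg_ne_zero_and_log {τ : ℍ} {u v : ℝ} (hβ : e (-u + v * τ) ≠ 1)
    (hα : ∀ j : ℕ, 1 - e (u + (1 - v) * τ) * e τ ^ j ≠ 0)
    (hβ' : ∀ j : ℕ, 1 - e (-u + v * τ) * e τ ^ (j + 1) ≠ 0)
    (hsα : Summable (fun j : ℕ => Real.log ‖1 - e (u + (1 - v) * τ) * e τ ^ j‖))
    (hsβ : Summable (fun j : ℕ => Real.log ‖1 - e (-u + v * τ) * e τ ^ (j + 1)‖)) :
    siegel (-v) u τ ≠ 0 ∧ Real.log ‖siegel (-v) u τ‖ = -(Real.pi * B₂ v * τ.im) +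
      (∑' j : ℕ, Real.log ‖1 - e (u + (1 - v) * τ) * e τ ^ j‖ +
       ∑' j : ℕ, Real.log ‖1 - e (-u + v * τ) * e τ ^ (j + 1)‖ +
       Real.log ‖1 - e (-u + v * τ)‖) := by
  set w := e ((-v : ℝ) * τ + u) with hw
  have hwβ : w⁻¹ = e (-u + v * τ) := by
    rw [hw, ← e_neg]; congr 1; push_cast; ring
  have hwα : ∀ j : ℕ, e τ ^ (j + 1) * w = e (u + (1 - v) * τ) * e τ ^ j := fun j => by
    rw [pow_succ, mul_assoc, hw, ← e_add, mul_comm]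
    congr 2; push_cast; ring
  have hwβ' : ∀ j : ℕ, e τ ^ (j + 1) / w = e (-u + v * τ) * e τ ^ (j + 1) := fun j => by
    rw [div_eq_mul_inv, hwβ, mul_comm]
  have hmult := multipliable_siegel (-v) u τ
  rw [← hw] at hmult
  simp only [hwα, hwβ'] at hmult
  have hlog : ∀ j : ℕ, Real.log ‖(1 - e (u + (1 - v) * τ) * e τ ^ j) *
      (1 - e (-u + v * τ) * e τ ^ (j + 1))‖ = Real.log ‖1 - e (u + (1 - v) * τ) * e τ ^ j‖ +
      Real.log ‖1 - e (-u + v * τ) * e τ ^ (j + 1)‖ := fun j => by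
    rw [norm_mul, Real.log_mul (norm_ne_zero_iff.mpr (hα j)) (norm_ne_zero_iff.mpr (hβ' j))]
  have hprod : ‖∏' j : ℕ, ((1 - e (u + (1 - v) * τ) * e τ ^ j) *
      (1 - e (-u + v * τ) * e τ ^ (j + 1)))‖ =
      Real.exp (∑' j : ℕ, Real.log ‖1 - e (u + (1 - v) * τ) * e τ ^ j‖ +
       ∑' j : ℕ, Real.log ‖1 - e (-u + v * τ) * e τ ^ (j + 1)‖) := by
    rw [hmult.norm_tprod, ← hsα.tsum_add hsβ, ← tsum_congr hlog, Real.rexp_tsum_eq_tprod]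
    · exact fun j => norm_pos_iff.mpr (mul_ne_zero (hα j) (hβ' j))
    · exact (hsα.add hsβ).congr fun j => (hlog j).symm
  have hw1 : ‖1 - w‖ = Real.exp (2 * Real.pi * v * τ.im) * ‖1 - e (-u + v * τ)‖ := by
    have e1 : 1 - w = -w * (1 - w⁻¹) := by
      have : w ≠ 0 := e_ne_zero _
      field_simp
      ring
    have him : (((-v : ℝ) : ℂ) * τ + u).im = -v * τ.im := by simp
    rw [e1, norm_mul, norm_neg, hwβ, hw, norm_e, him]
    congr 2
    ring
  have hβn : ‖1 - e (-u + v * τ)‖ ≠ 0 := norm_ne_zero_iff.mpr (sub_ne_zero.mpr hβ.symm)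
  have hnorm : ‖siegel (-v) u τ‖ = Real.exp (-(Real.pi * B₂ v * τ.im) +
      (∑' j : ℕ, Real.log ‖1 - e (u + (1 - v) * τ) * e τ ^ j‖ +
       ∑' j : ℕ, Real.log ‖1 - e (-u + v * τ) * e τ ^ (j + 1)‖)) * ‖1 - e (-u + v * τ)‖ := by
    rw [norm_siegel, ← hw, theta, norm_mul]
    simp only [hwα, hwβ']
    rw [hprod, hw1, mul_right_comm (Real.exp (2 * Real.pi * v * τ.im)), ← mul_assoc, ← mul_assoc,
      ← Real.exp_add, ← Real.exp_add]
    congr 2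
    simp only [B₂]
    ring
  constructor
  · rw [← norm_ne_zero_iff, hnorm]
    exact mul_ne_zero (Real.exp_pos _).ne' hβn
  · rw [hnorm, Real.log_mul (Real.exp_pos _).ne' hβn, Real.log_exp]
    ring

/-! ### Kronecker's formula and the theorem -/

/-- Kronecker's second limit formula. -/
theorem kronecker_second_limit {τ : ℍ} {ψ : LatticeChar τ} {u v : ℝ}
    (huv : ¬((∃ k : ℤ, u = k) ∧ (∃ k : ℤ, v = k)))
    (h1 : (ψ (one τ) : ℂ) = e v) (hg : (ψ (gen τ) : ℂ) = e u) :
    siegel (-v) u τ ≠ 0 ∧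
      L τ ψ = ((-(2 * Real.pi) / τ.im * Real.log ‖siegel (-v) u τ‖ : ℝ) : ℂ) := by
  -- Both e(v) and |g| depend only on v modulo 1, so v may be replaced by its fractional part.
  have hperiod : ‖siegel (-v) u τ‖ = ‖siegel (-Int.fract v) u τ‖ := by
    have h := (norm_siegel_periodic u τ).sub_zsmul_eq (x := -Int.fract v) ⌊v⌋
    rw [← h]
    congr 2
    rw [Int.fract, zsmul_one]
    ring
  have hv : Int.fract v ∈ Set.Ico (0 : ℝ) 1 := ⟨Int.fract_nonneg v, Int.fract_lt_one v⟩
  have hev : e ((Int.fract v : ℝ) : ℂ) = e v := by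
    rw [Int.fract, Complex.ofReal_sub, Complex.ofReal_intCast, e_sub, e_intCast, div_one]
  have huv' : ¬((∃ k : ℤ, u = k) ∧ Int.fract v = 0) := fun h =>
    huv ⟨h.1, ⌊v⌋, by rw [← sub_eq_zero]; exact h.2⟩
  rw [← hev] at h1
  rw [← norm_ne_zero_iff, hperiod, norm_ne_zero_iff]
  generalize Int.fract v = v at *
  obtain ⟨hβ, hsα, hsβ, hL⟩ := L_eq_log hv huv' h1 hg
  have hy := τ.im_pos
  have hne : ∀ c : ℂ, 0 < c.im → ∀ j : ℕ, 1 - e c * e τ ^ j ≠ 0 := fun c hc j => by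
    rw [← e_natCast_mul, ← e_add]
    refine one_sub_e_ne_zero ?_
    have : (c + j * τ).im = c.im + j * τ.im := by simp
    rw [this]
    positivity
  have hα : ∀ j : ℕ, 1 - e (u + (1 - v) * τ) * e τ ^ j ≠ 0 := hne _ (by
    have e1 : ((u : ℂ) + (1 - v) * τ).im = (1 - v) * τ.im := by simp [Complex.mul_im]
    rw [e1]
    exact mul_pos (by linarith [hv.2]) hy)
  have hβ' : ∀ j : ℕ, 1 - e (-u + v * τ) * e τ ^ (j + 1) ≠ 0 := fun j => by
    -- One power of q is absorbed into the exponent, since -u + vτ is real when v = 0.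
    have h := hne (-u + v * τ + τ) (by
      have e1 : (-(u : ℂ) + v * τ + τ).im = v * τ.im + τ.im := by simp [Complex.mul_im]
      rw [e1]
      have := hv.1
      positivity) j
    rwa [e_add, mul_assoc, ← pow_succ'] at h
  obtain ⟨hs0, hslog⟩ := siegel_neg_ne_zero_and_log hβ hα hβ' hsα hsβ
  refine ⟨hs0, ?_⟩
  rw [hL, hslog]
  congr 1
  field_simp
  ring

end LatticeSum

theorem mainTheorem12 (τ : ℍ) :
    -- the trivial character
    (∃ η : ℝ, (fun x : ℝ => LatticeSum.Z τ 1 x -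
        ((Real.pi / ZLattice.covolume (LatticeSum.lattice τ) * (Real.log x + η) : ℝ) : ℂ))
      =O[atTop] fun x : ℝ => x ^ (-(1 / 2) : ℝ)) ∧
    -- nontrivial characters: convergence, with a rate
    (∀ ψ : LatticeSum.LatticeChar τ, ψ ≠ 1 →
      Tendsto (LatticeSum.Z τ ψ) atTop (𝓝 (LatticeSum.L τ ψ)) ∧
      (fun x : ℝ => LatticeSum.Z τ ψ x - LatticeSum.L τ ψ)
        =O[atTop] fun x : ℝ => x ^ (-(1 / 2) : ℝ)) ∧
    -- evaluation of the limit
    (∀ (ψ : LatticeSum.LatticeChar τ) (u v : ℝ),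
      ¬ ((∃ k : ℤ, u = k) ∧ (∃ k : ℤ, v = k)) →
      (ψ (LatticeSum.one τ) : ℂ) = LatticeSum.e v →
      (ψ (LatticeSum.gen τ) : ℂ) = LatticeSum.e u →
      ψ ≠ 1 ∧ LatticeSum.siegel (-v) u τ ≠ 0 ∧
      LatticeSum.L τ ψ =
        ((-(2 * Real.pi) / τ.im * Real.log ‖LatticeSum.siegel (-v) u τ‖ : ℝ) : ℂ)) := by
  refine ⟨LatticeSum.Z_one_asymptotic τ,
    fun ψ hψ => ⟨LatticeSum.Z_tendsto_L τ hψ, LatticeSum.Z_sub_L_isBigO τ hψ⟩,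
    fun ψ u v huv h1 hg => ⟨?_, LatticeSum.kronecker_second_limit huv h1 hg⟩⟩
  rintro rfl
  refine huv ⟨?_, ?_⟩
  · rw [← LatticeSum.e_ofReal_eq_one_iff, ← hg]; simp
  · rw [← LatticeSum.e_ofReal_eq_one_iff, ← h1]; simp
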